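/- Let $\mathcal H$ be a separable complex Hilbert space and let $H_0,H_1$ be self-adjoint operators with $H_0\ge 1+\gamma_0$ for some $\gamma_0>0$, such that $H_1$ is $H_0^{1/2}$-bounded: $D(H_0^{1/2})\subset D(H_1)$ and $\|H_1\psi\|\le \tilde a\|H_0^{1/2}\psi\|+\tilde b\|\psi\|$ for $\psi\in D(H_0^{1/2})$, with $\tilde a,\tilde b\ge 0$. Let $g\in C^1(\mathbb R)$ be real-valued with $\operatorname{supp} g'\subset(0,1)$ and $g(s)=0$ for $s<0$, and put $M=\max_{[0,1]}|g|$, $M'=\max_{[0,1]}|g'|$, $\phi(s)=\int_0^s g(u)\,du$. Let $\varepsilon_*>0$ satisfy $\frac{3\gamma_0+1}{\gamma_0}\,\varepsilon_*M\|H_1H_0^{-1}\|<1$. For $\varepsilon\in(0,\varepsilon_*]$, $\eta>0$ and $t,s\in\mathbb R$ set $$H(\varepsilon,\eta,t)=H_0+\varepsilon g(\eta t)H_1,\qquad \hat H(\varepsilon,\eta,s)=e^{i\frac{\varepsilon}{\eta}\phi(s)H_1}H_0\,e^{-i\frac{\varepsilon}{\eta}\phi(s)H_1}.$$ Assume that $e^{i\lambda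 H_1}D(H_0)\subset D(H_0)$ for all $\lambda\in\mathbb R$. Let $n\in\mathbb Z$ and assume moreover: * (B.1) if $|n|\ge 2$: for every integer $2\le k\le |n|$, $D(H_0^k)$ is dense and $D(H(\varepsilon,\eta,t)^k)=D(H_0^k)$ for all $\varepsilon\in(0,\varepsilon_*]$, $\eta>0$, $t\in\mathbb R$; * (B.2) if $|n|\ge 1$: the commutator $[H_1,H_0]$ is given by an operator whose domain contains $D(H_0^{1/2})$, in the sense that $\langle\varphi,[H_1,H_0]\psi\rangle=\langle H_1\varphi,H_0\psi\rangle-\langle H_0\varphi,H_1\psi\rangle$ for all $\varphi,\psi\in D(H_0)$; and for every integer $-|n|\le k\le |n|-2$ there is a constant $E_k$ such that, for all $\varepsilon\in(0,\varepsilon_*]$, $\eta>0$, $t\in\mathbb R$, the composition $H^{k/2}(\varepsilon,\eta,t)\,[H_1,H_0]\,H^{-(k+2)/2}(\varepsilon,\eta,t)$ is well defined (i.e. $[H_1,H_0]H^{-(k+2)/2}(\varepsilon,\eta,t)$ maps its natural domain into $D(H^{k/2}(\varepsilon,\eta,t))$), densely defined, and has norm at most $E_k$. Define $\alpha=M'(\tilde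 a+\tilde b)$, $\beta=3M'M\tilde a\,\|H_1H_0^{-1/2}\|$, $\gamma_m=M'\sum_{k=1}^m E_{-k}$, and $$C_0(\varepsilon)=1,\qquad C_m(\varepsilon)=C_{m-1}(\varepsilon)\,e^{C_{m-1}(\varepsilon)(\alpha+\beta\varepsilon+\gamma_m)\varepsilon}\quad(m\ge 1),\qquad C_{-m}(\varepsilon)=C_m(\varepsilon).$$ Then there is a constant $D_n$, independent of $(\varepsilon,\eta)\in(0,\varepsilon_*]\times(0,\infty)$, such that for all $\varepsilon\in(0,\varepsilon_*]$ and $\eta>0$ the following holds. Let $\hat U(s,u)=\hat U_{\varepsilon,\eta}(s,u)$ be the unitary propagator generated by $\hat H(\varepsilon,\eta,\cdot)$, i.e. a jointly strongly continuous family of unitary operators with $\hat U(s,r)\hat U(r,u)=\hat U(s,u)$, $\hat U(s,s)=\mathrm{Id}$, $\hat U(s,u)D(H_0)=D(H_0)$ and, for $\psi\in D(H_0)$, $$i\eta\,\partial_s\hat U(s,u)\psi=\hat H(\varepsilon,\eta,s)\hat U(s,u)\psi,\qquad i\eta\,\partial_u\hat U(s,u)\psi=-\hat U(s,u)\hat H(\varepsilon,\eta,u)\psi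 .$$ Then for all $s,u\in\mathbb R$ the operator $\hat H^{-n/2}(\varepsilon,\eta,s)\,\hat U(s,u)\,\hat H^{n/2}(\varepsilon,\eta,u)$ is well defined on the whole (dense) domain $D(\hat H^{n/2}(\varepsilon,\eta,u))$, and $$\sup_{s,u\in\mathbb R}\big\|\hat H^{-n/2}(\varepsilon,\eta,s)\,\hat U(s,u)\,\hat H^{n/2}(\varepsilon,\eta,u)\big\|\le C_n(\varepsilon)\,(1+\varepsilon D_n).$$ -/

import Mathlib

open scoped InnerProductSpace

noncomputable section

namespace EnergyBounds

variable {ℋ : Type*} [NormedAddCommGroup ℋ] [InnerProductSpace ℂ ℋ]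

/-- A bounded operator, viewed as an operator with domain the whole space. -/
def ofBounded (T : ℋ →L[ℂ] ℋ) : ℋ →ₗ.[ℂ] ℋ := (T : ℋ →ₗ[ℂ] ℋ).toPMap ⊤

/-- The vectors `x` in the domain of `B` with `B x` in the domain of `A`. -/
def compDomain (A B : ℋ →ₗ.[ℂ] ℋ) : Submodule ℂ ℋ :=
  (A.domain.comap B.toFun).map B.domain.subtype

theorem mem_compDomain {A B : ℋ →ₗ.[ℂ] ℋ} {x : ℋ} :
    x ∈ compDomain A B ↔ ∃ hx : x ∈ B.domain, B ⟨x, hx⟩ ∈ A.domain := by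
  simp [compDomain]

/-- The product `A B` of unbounded operators on its natural domain
`{x ∈ D(B) | B x ∈ D(A)}`. -/
def comp (A B : ℋ →ₗ.[ℂ] ℋ) : ℋ →ₗ.[ℂ] ℋ :=
  A.comp (B.domRestrict (compDomain A B)) (fun x => by
    obtain ⟨_, h⟩ := mem_compDomain.1 x.2.1
    exact h)

theorem mem_comp_domain {A B : ℋ →ₗ.[ℂ] ℋ} {x : ℋ} :
    x ∈ (comp A B).domain ↔ ∃ hx : x ∈ B.domain, B ⟨x, hx⟩ ∈ A.domain := by
  refine ⟨fun h => mem_compDomain.1 h.1, fun h => ⟨mem_compDomain.2 h, h.1⟩⟩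

theorem comp_apply {A B : ℋ →ₗ.[ℂ] ℋ} {x : ℋ} (h : x ∈ (comp A B).domain)
    (hx : x ∈ B.domain) (hBx : B ⟨x, hx⟩ ∈ A.domain) :
    comp A B ⟨x, h⟩ = A ⟨B ⟨x, hx⟩, hBx⟩ := rfl

/-- `‖A‖ ≤ c` for a densely defined operator `A`. -/
def NormLE (A : ℋ →ₗ.[ℂ] ℋ) (c : ℝ) : Prop :=
  Dense (A.domain : Set ℋ) ∧ ∀ x : A.domain, ‖A x‖ ≤ c * ‖(x : ℋ)‖

/-- The operator norm `‖A‖` of a bounded, possibly partially defined, operator. -/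
def opNorm (A : ℋ →ₗ.[ℂ] ℋ) : ℝ :=
  sInf {c : ℝ | 0 ≤ c ∧ ∀ x : A.domain, ‖A x‖ ≤ c * ‖(x : ℋ)‖}

/-- `B` is the everywhere defined bounded inverse of `A`: the graph of `A` is the transposed
graph of `B`. -/
def IsBoundedInverse (A : ℋ →ₗ.[ℂ] ℋ) (B : ℋ →L[ℂ] ℋ) : Prop :=
  ∀ x y : ℋ, (x, y) ∈ A.graph ↔ x = B y

open Classical in
/-- The bounded inverse `A⁻¹` (the zero operator if `A` has no bounded inverse). -/
def inv (A : ℋ →ₗ.[ℂ] ℋ) : ℋ →L[ℂ] ℋ :=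
  if h : ∃ B, IsBoundedInverse A B then h.choose else 0

/-- `A^{-1/2}`, the positive square root of the bounded positive operator `A⁻¹`, for a
self-adjoint operator `A` with strictly positive lower bound. -/
def invSqrt [CompleteSpace ℋ] (A : ℋ →ₗ.[ℂ] ℋ) : ℋ →L[ℂ] ℋ := CFC.sqrt (inv A)

/-- `A^{n/2}` for `n : ℤ` and a self-adjoint operator `A` with strictly positive lower bound:
for `n ≤ 0` it is the bounded operator `(A^{-1/2})^{|n|}`, and for `n > 0` it is the inverse of
`(A^{-1/2})^n`, with domain the range of the latter. -/
def halfPow [CompleteSpace ℋ] (A : ℋ →ₗ.[ℂ] ℋ) (n : ℤ) : ℋ →ₗ.[ℂ] ℋ :=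
  if n ≤ 0 then ofBounded (invSqrt A ^ n.natAbs)
  else (ofBounded (invSqrt A ^ n.natAbs)).inverse

/-- `V` is the strongly continuous one-parameter unitary group with infinitesimal generator `A`
(that is, `V l = exp (i l A)`): `x ∈ D(A)` with `A x = y` exactly when `l ↦ V l x` is
differentiable at `0` with derivative `i y`. -/
structure IsUnitaryGroup [CompleteSpace ℋ] (A : ℋ →ₗ.[ℂ] ℋ)
    (V : ℝ → unitary (ℋ →L[ℂ] ℋ)) : Prop where
  zero : V 0 = 1
  add : ∀ l m : ℝ, V (l + m) = V l * V m
  continuous : ∀ x : ℋ, Continuous fun l : ℝ => (V l : ℋ →L[ℂ] ℋ) x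
  generator : ∀ x y : ℋ, (x, y) ∈ A.graph ↔
    HasDerivAt (fun l : ℝ => (V l : ℋ →L[ℂ] ℋ) x) (Complex.I • y) 0

open Classical in
/-- `exp (i l A)` for a self-adjoint operator `A`. -/
def expI [CompleteSpace ℋ] (A : ℋ →ₗ.[ℂ] ℋ) (l : ℝ) : unitary (ℋ →L[ℂ] ℋ) :=
  if h : ∃ V, IsUnitaryGroup A V then h.choose l else 1

/-- The transformed operator `W A W*`, with domain `W D(A)`. -/
def conj [CompleteSpace ℋ] (W : unitary (ℋ →L[ℂ] ℋ)) (A : ℋ →ₗ.[ℂ] ℋ) : ℋ →ₗ.[ℂ] ℋ :=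
  comp (ofBounded (W : ℋ →L[ℂ] ℋ)) (comp A (ofBounded ((star W : unitary (ℋ →L[ℂ] ℋ)) : ℋ →L[ℂ] ℋ)))

/-- The perturbed Hamiltonian `H(ε, η, t) = H₀ + ε g(η t) H₁`. -/
def perturbed (H₀ H₁ : ℋ →ₗ.[ℂ] ℋ) (g : ℝ → ℝ) (ε η t : ℝ) : ℋ →ₗ.[ℂ] ℋ :=
  H₀ + ((ε * g (η * t) : ℝ) : ℂ) • H₁

/-- `φ(s) = ∫₀ˢ g(u) du`. -/
def phase (g : ℝ → ℝ) (s : ℝ) : ℝ := ∫ u in (0 : ℝ)..s, g u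

/-- The Hamiltonian in the interaction picture,
`Ĥ(ε, η, s) = exp(i (ε/η) φ(s) H₁) H₀ exp(-i (ε/η) φ(s) H₁)`. -/
def interaction [CompleteSpace ℋ] (H₀ H₁ : ℋ →ₗ.[ℂ] ℋ) (g : ℝ → ℝ) (ε η s : ℝ) : ℋ →ₗ.[ℂ] ℋ :=
  conj (expI H₁ (ε / η * phase g s)) H₀

/-- `M = max_{[0,1]} |g|`; applied to `deriv g` it gives `M' = max_{[0,1]} |g'|`. -/
def maxAbs (g : ℝ → ℝ) : ℝ := sSup ((fun s => |g s|) '' Set.Icc 0 1)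

/-- The standing assumptions on `H₀`, `H₁`, `g` and the intensity threshold `ε⋆`. The numbers
`a`, `b` are relative bounds of `H₁` with respect to `H₀^{1/2}`. -/
structure Standing [CompleteSpace ℋ] (H₀ H₁ : ℋ →ₗ.[ℂ] ℋ) (g : ℝ → ℝ)
    (γ₀ εs a b : ℝ) : Prop where
  contDiff : ContDiff ℝ 1 g
  support : tsupport (deriv g) ⊆ Set.Ioo 0 1
  zero_of_neg : ∀ s < 0, g s = 0
  selfAdjoint₀ : IsSelfAdjoint H₀
  gap_pos : 0 < γ₀
  lower : ∀ x : H₀.domain, (1 + γ₀) * ‖(x : ℋ)‖ ^ 2 ≤ (⟪(x : ℋ), H₀ x⟫_ℂ).re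
  selfAdjoint₁ : IsSelfAdjoint H₁
  a_nonneg : 0 ≤ a
  b_nonneg : 0 ≤ b
  domain_le : (halfPow H₀ 1).domain ≤ H₁.domain
  relBound : ∀ (x : ℋ) (h₀ : x ∈ (halfPow H₀ 1).domain) (h₁ : x ∈ H₁.domain),
    ‖H₁ ⟨x, h₁⟩‖ ≤ a * ‖halfPow H₀ 1 ⟨x, h₀⟩‖ + b * ‖x‖
  threshold_pos : 0 < εs
  threshold : (3 * γ₀ + 1) / γ₀ * εs * maxAbs g * opNorm (comp H₁ (halfPow H₀ (-2))) < 1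

/-- The domain condition (B₁(k)): `D(H(ε,η,t)^k) = D(H₀^k)`, a dense subspace. -/
def PowerDomain [CompleteSpace ℋ] (H₀ H₁ : ℋ →ₗ.[ℂ] ℋ) (g : ℝ → ℝ) (εs : ℝ) (k : ℕ) : Prop :=
  Dense ((halfPow H₀ (2 * k)).domain : Set ℋ) ∧
  ∀ ε ∈ Set.Ioc 0 εs, ∀ η > 0, ∀ t : ℝ,
    (halfPow (perturbed H₀ H₁ g ε η t) (2 * k)).domain = (halfPow H₀ (2 * k)).domain

/-- `K` is the commutator `[H₁, H₀]`, as an operator whose domain contains `D(H₀^{1/2})`. On its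
natural domain `H₁ H₀ - H₀ H₁` need not be defined on enough vectors, so the identity
`K = H₁ H₀ - H₀ H₁` is tested against `D(H₀)`; this determines `K` on `D(H₀)`. -/
def IsCommutator [CompleteSpace ℋ] (H₀ H₁ K : ℋ →ₗ.[ℂ] ℋ) : Prop :=
  (halfPow H₀ 1).domain ≤ K.domain ∧
  ∀ (x y : ℋ) (hx : x ∈ H₀.domain) (hy : y ∈ H₀.domain) (hx₁ : x ∈ H₁.domain)
    (hy₁ : y ∈ H₁.domain) (hyK : y ∈ K.domain),
    ⟪x, K ⟨y, hyK⟩⟫_ℂ = ⟪H₁ ⟨x, hx₁⟩, H₀ ⟨y, hy⟩⟫_ℂ - ⟪H₀ ⟨x, hx⟩, H₁ ⟨y, hy₁⟩⟫_ℂ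

/-- The commutator condition (B₂(k)) with constant `E`: the product
`H^{k/2} [H₁,H₀] H^{-(k+2)/2}`, `H = H(ε,η,t)`, is well defined wherever
`[H₁,H₀] H^{-(k+2)/2}` is, and its norm is at most `E`, uniformly in `ε`, `η`, `t`. -/
def CommutatorBound [CompleteSpace ℋ] (H₀ H₁ K : ℋ →ₗ.[ℂ] ℋ) (g : ℝ → ℝ) (εs : ℝ) (k : ℤ)
    (E : ℝ) : Prop :=
  IsCommutator H₀ H₁ K ∧
  ∀ ε ∈ Set.Ioc 0 εs, ∀ η > 0, ∀ t : ℝ,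
    let H := perturbed H₀ H₁ g ε η t
    let R := comp K (halfPow H (-(k + 2)))
    (comp (halfPow H k) R).domain = R.domain ∧ NormLE (comp (halfPow H k) R) E

/-- `D(H₀)` is invariant under `exp(i l H₁)` for every real `l`. -/
def DomainInvariant [CompleteSpace ℋ] (H₀ H₁ : ℋ →ₗ.[ℂ] ℋ) : Prop :=
  ∀ l : ℝ, ∀ x ∈ H₀.domain, (expI H₁ l : ℋ →L[ℂ] ℋ) x ∈ H₀.domain

/-- `U` is the unitary propagator with time-independent domain `D` generated by the family
`A s`, at time scale `η`: `i η ∂ₛ U(s,u) x = A(s) U(s,u) x` and `i η ∂ᵤ U(s,u) x = -U(s,u) A(u) x`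
for `x ∈ D`. -/
structure IsPropagator [CompleteSpace ℋ] (D : Submodule ℂ ℋ) (A : ℝ → ℋ →ₗ.[ℂ] ℋ) (η : ℝ)
    (U : ℝ → ℝ → unitary (ℋ →L[ℂ] ℋ)) : Prop where
  continuous : ∀ x : ℋ, Continuous fun p : ℝ × ℝ => (U p.1 p.2 : ℋ →L[ℂ] ℋ) x
  cocycle : ∀ s r u : ℝ, U s r * U r u = U s u
  refl : ∀ s : ℝ, U s s = 1
  map_domain : ∀ s u : ℝ, (fun x => (U s u : ℋ →L[ℂ] ℋ) x) '' (D : Set ℋ) = D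
  deriv_left : ∀ s u : ℝ, ∀ x ∈ D, ∃ d : ℋ,
    HasDerivAt (fun r : ℝ => (U r u : ℋ →L[ℂ] ℋ) x) d s ∧
    ((U s u : ℋ →L[ℂ] ℋ) x, (Complex.I * (η : ℂ)) • d) ∈ (A s).graph
  deriv_right : ∀ s u : ℝ, ∀ x ∈ D, ∃ d y : ℋ,
    HasDerivAt (fun r : ℝ => (U s r : ℋ →L[ℂ] ℋ) x) d u ∧ (x, y) ∈ (A u).graph ∧
    (Complex.I * (η : ℂ)) • d = -(U s u : ℋ →L[ℂ] ℋ) y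

/-- `γ_m = M' ∑_{k=1}^m E_{-k}`. -/
def gammaConst (g : ℝ → ℝ) (E : ℤ → ℝ) (m : ℕ) : ℝ :=
  maxAbs (deriv g) * ∑ k ∈ Finset.Icc 1 m, E (-(k : ℤ))

/-- `α = M' (a + b)`. -/
def alphaConst (g : ℝ → ℝ) (a b : ℝ) : ℝ := maxAbs (deriv g) * (a + b)

/-- `β = 3 M' a M ‖H₁ H₀^{-1/2}‖`. -/
def betaConst [CompleteSpace ℋ] (H₀ H₁ : ℋ →ₗ.[ℂ] ℋ) (g : ℝ → ℝ) (a : ℝ) : ℝ :=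
  maxAbs (deriv g) * (3 * a * maxAbs g * opNorm (comp H₁ (halfPow H₀ (-1))))

/-- `C₀(ε) = 1` and `C_m(ε) = C_{m-1}(ε) exp(C_{m-1}(ε) (α + β ε + γ_m) ε)`. -/
def energyConst (α β : ℝ) (γ : ℕ → ℝ) (ε : ℝ) : ℕ → ℝ
  | 0 => 1
  | m + 1 => energyConst α β γ ε m *
      Real.exp (energyConst α β γ ε m * (α + β * ε + γ (m + 1)) * ε)

end EnergyBounds

end

/-!
The operator `Ĥ(s)^{-n/2} Û(s,u) Ĥ(u)^{n/2}` is bounded by comparing bounded operators only. Put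
`m = |n|`. The claim for `n ≥ 0` is the inequality
`‖Ĥ(s)^{-m/2} Û(s,u) x‖ ≤ C ‖Ĥ(u)^{-m/2} x‖` for all `x`, and the claim for `n ≤ 0` follows from
the same inequality for `Û(u,s) = Û(s,u)*` by Douglas' range inclusion
(`exists_apply_eq_of_norm_adjoint_le`, `normLE_halfPow_comp`).

Undoing the gauge transformation `exp (i (ε/η) φ(s) H₁)`, which exists by Stone's theorem
(`exists_isUnitaryGroup`), turns `Û(s,u) x` into a solution of `i η y' = H_s y` with
`H_s = H₀ + ε g(s) H₁` (`IsPropagator.exists_schrodinger`). Let `R_s = H_s⁻¹` and consider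
`f(s) = ⟨y_s, R_s^m y_s⟩ = ‖H_s^{-m/2} y_s‖²`. The motion of `y` does not contribute to `f'`, because
`H_s` commutes with `R_s^m`, so that
`f'(s) = - ε g'(s) ∑_{i < m} ⟨y_s, R_s^{m-i} H₁ R_s^{i+1} y_s⟩`.
Only integer powers of `R_s` are differentiated, also when `m` is odd. Each term is bounded by
`f(s)` times the norm of some `H_s^{-q/2} H₁ H_s^{(q-2)/2}` with `1 ≤ q ≤ m`. For `q = 1, 2` this
norm is controlled by the relative bound of `H₁`, and passing from `q` to `q + 2` costs the
commutator `H_s^{-(q+2)/2} [H₁, H₀] H_s^{q/2}`, whose norm is at most `E_{-(q+2)}`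
(`norm_pow_mul_le`). Since every norm is needed for at most two values of `i`,
Grönwall's inequality and `∫ |g'| ≤ M'` give a growth factor of at most
`exp (ε ∑_{q ≤ m} (α + β ε + γ_q))` (`ResolventFamily.norm_pow_le`), which is at most `C_m(ε)`
(`exp_energyExponent_le`).

The same estimate, applied to a constant vector `y`, compares `H_s^{-m/2}` with `H₀^{-m/2}`, because
the perturbation is switched off at negative times. Both comparisons, at `s` and at `u`, cost
`exp O(ε)`, which is the factor `1 + ε D`.

Invertibility of `H_s` and the bound `‖R_s‖ ≤ 1` come from the Neumann series
`R_s = R_0 (1 + ε g(s) H₁ R_0)⁻¹`, for which the threshold on `ε` is made.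
-/

noncomputable section

namespace EnergyBounds

variable {ℋ : Type*} [NormedAddCommGroup ℋ] [InnerProductSpace ℂ ℋ]

/-! ### Graphs of partially defined operators -/

theorem mem_graph_ofBounded {T : ℋ →L[ℂ] ℋ} {x y : ℋ} :
    (x, y) ∈ (ofBounded T).graph ↔ y = T x := by
  rw [LinearPMap.mem_graph_iff]
  constructor
  · rintro ⟨z, rfl, h⟩
    exact h.symm
  · rintro rfl
    exact ⟨⟨x, trivial⟩, rfl, rfl⟩

theorem mem_graph_comp {A B : ℋ →ₗ.[ℂ] ℋ} {x z : ℋ} :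
    (x, z) ∈ (comp A B).graph ↔ ∃ y, (x, y) ∈ B.graph ∧ (y, z) ∈ A.graph := by
  constructor
  · rw [LinearPMap.mem_graph_iff]
    rintro ⟨w, rfl, hw⟩
    obtain ⟨hx, hBx⟩ := mem_comp_domain.1 w.2
    refine ⟨B ⟨w, hx⟩, B.mem_graph ⟨w, hx⟩, ?_⟩
    rw [← show comp A B w = z from hw]
    exact A.mem_graph ⟨B ⟨w, hx⟩, hBx⟩
  · rintro ⟨y, hy, hz⟩
    obtain ⟨u, rfl, rfl⟩ := (LinearPMap.mem_graph_iff _).1 hy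
    obtain ⟨v, hv, rfl⟩ := (LinearPMap.mem_graph_iff _).1 hz
    have hBu : B u ∈ A.domain := by
      have h := v.2
      rw [hv] at h
      exact h
    have hmem : (u : ℋ) ∈ (comp A B).domain := mem_comp_domain.2 ⟨u.2, hBu⟩
    refine (LinearPMap.mem_graph_iff _).2 ⟨⟨u, hmem⟩, rfl, ?_⟩
    rw [comp_apply hmem u.2 hBu]
    congr 1
    exact Subtype.ext hv.symm

theorem mem_domain_iff_graph {A : ℋ →ₗ.[ℂ] ℋ} {x : ℋ} :
    x ∈ A.domain ↔ ∃ y, (x, y) ∈ A.graph :=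
  LinearPMap.mem_domain_iff

theorem graph_unique {A : ℋ →ₗ.[ℂ] ℋ} {x y z : ℋ} (hy : (x, y) ∈ A.graph)
    (hz : (x, z) ∈ A.graph) : y = z :=
  LinearPMap.mem_graph_snd_inj _ hy hz rfl

theorem apply_eq_of_mem_graph {A : ℋ →ₗ.[ℂ] ℋ} {x y : ℋ} (h : (x, y) ∈ A.graph)
    (hx : x ∈ A.domain) : A ⟨x, hx⟩ = y :=
  graph_unique (A.mem_graph ⟨x, hx⟩) h

theorem mem_graph_perturbation {A B : ℋ →ₗ.[ℂ] ℋ} {c : ℂ} {x y : ℋ} :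
    (x, y) ∈ (A + c • B).graph ↔
      ∃ u v, (x, u) ∈ A.graph ∧ (x, v) ∈ B.graph ∧ y = u + c • v := by
  constructor
  · rw [LinearPMap.mem_graph_iff]
    rintro ⟨w, rfl, hw⟩
    exact ⟨_, _, A.mem_graph ⟨w, w.2.1⟩, B.mem_graph ⟨w, w.2.2⟩, hw.symm⟩
  · rintro ⟨u, v, hu, hv, rfl⟩
    obtain ⟨p, rfl, rfl⟩ := (LinearPMap.mem_graph_iff _).1 hu
    obtain ⟨q, hq, rfl⟩ := (LinearPMap.mem_graph_iff _).1 hv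
    have hpB : (p : ℋ) ∈ B.domain := by
      have h := q.2
      rw [hq] at h
      exact h
    have hq' : q = ⟨p, hpB⟩ := Subtype.ext hq
    refine (LinearPMap.mem_graph_iff _).2 ⟨⟨p, ⟨p.2, hpB⟩⟩, rfl, ?_⟩
    rw [hq']
    rfl

theorem NormLE.of_graph {A : ℋ →ₗ.[ℂ] ℋ} {c : ℝ} (hd : Dense (A.domain : Set ℋ))
    (h : ∀ x y, (x, y) ∈ A.graph → ‖y‖ ≤ c * ‖x‖) : NormLE A c :=
  ⟨hd, fun x => h _ _ (A.mem_graph x)⟩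

theorem NormLE.graph_le {A : ℋ →ₗ.[ℂ] ℋ} {c : ℝ} (h : NormLE A c) {x y : ℋ}
    (hxy : (x, y) ∈ A.graph) : ‖y‖ ≤ c * ‖x‖ := by
  obtain ⟨u, rfl, rfl⟩ := (LinearPMap.mem_graph_iff _).1 hxy
  exact h.2 u

theorem NormLE.nonneg [Nontrivial ℋ] {A : ℋ →ₗ.[ℂ] ℋ} {c : ℝ} (h : NormLE A c) : 0 ≤ c := by
  obtain ⟨x, hx, hx0⟩ := h.1.exists_mem_open (isOpen_compl_singleton (x := (0 : ℋ)))
    (exists_ne 0)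
  have h1 := (norm_nonneg _).trans (h.2 ⟨x, hx⟩)
  exact nonneg_of_mul_nonneg_left h1 (norm_pos_iff.2 hx0)

theorem opNorm_nonneg (A : ℋ →ₗ.[ℂ] ℋ) : 0 ≤ opNorm A :=
  Real.sInf_nonneg fun _ h => h.1

/-- The infimum defining the operator norm is attained as soon as some bound exists. -/
theorem norm_le_opNorm {A : ℋ →ₗ.[ℂ] ℋ} {c : ℝ} (hc : 0 ≤ c)
    (hA : ∀ x y, (x, y) ∈ A.graph → ‖y‖ ≤ c * ‖x‖) {x y : ℋ} (h : (x, y) ∈ A.graph) :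
    ‖y‖ ≤ opNorm A * ‖x‖ := by
  obtain ⟨u, rfl, rfl⟩ := (LinearPMap.mem_graph_iff _).1 h
  rcases (norm_nonneg (u : ℋ)).eq_or_lt with h0 | h0
  · have := hA _ _ h
    rw [← h0, mul_zero] at this ⊢
    exact this
  · rw [← div_le_iff₀ h0]
    refine le_csInf ⟨c, hc, fun x => hA _ _ (A.mem_graph x)⟩ ?_
    rintro b ⟨_, hb⟩
    rw [div_le_iff₀ h0]
    exact hb u

/-! ### Bounded inverses -/

theorem IsBoundedInverse.unique {A : ℋ →ₗ.[ℂ] ℋ} {B C : ℋ →L[ℂ] ℋ}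
    (hB : IsBoundedInverse A B) (hC : IsBoundedInverse A C) : B = C := by
  ext y
  exact (hC _ _).1 ((hB (B y) y).2 rfl)

theorem IsBoundedInverse.inv_eq {A : ℋ →ₗ.[ℂ] ℋ} {B : ℋ →L[ℂ] ℋ}
    (hB : IsBoundedInverse A B) : inv A = B := by
  have h : ∃ B, IsBoundedInverse A B := ⟨B, hB⟩
  rw [inv, dif_pos h]
  exact h.choose_spec.unique hB

theorem IsBoundedInverse.mem_graph {A : ℋ →ₗ.[ℂ] ℋ} {B : ℋ →L[ℂ] ℋ}
    (hB : IsBoundedInverse A B) (y : ℋ) : (B y, y) ∈ A.graph :=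
  (hB _ _).2 rfl

theorem IsBoundedInverse.injective {A : ℋ →ₗ.[ℂ] ℋ} {B : ℋ →L[ℂ] ℋ}
    (hB : IsBoundedInverse A B) : Function.Injective B := by
  intro x y hxy
  have := hB.mem_graph y
  rw [← hxy] at this
  exact graph_unique (hB.mem_graph x) this

section Resolvent

variable [CompleteSpace ℋ]

theorem graph_symmetric {A : ℋ →ₗ.[ℂ] ℋ} (hA : IsSelfAdjoint A) {x y u v : ℋ}
    (h : (x, y) ∈ A.graph) (h' : (u, v) ∈ A.graph) : ⟪x, v⟫_ℂ = ⟪y, u⟫_ℂ := by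
  obtain ⟨p, rfl, rfl⟩ := (LinearPMap.mem_graph_iff _).1 h
  obtain ⟨q, rfl, rfl⟩ := (LinearPMap.mem_graph_iff _).1 h'
  have h1 := A.adjoint_isFormalAdjoint hA.dense_domain
  rw [LinearPMap.isSelfAdjoint_def.1 hA] at h1
  exact (h1 p q).symm

/-- Maximality of a self-adjoint operator: a pair that is compatible with its graph belongs
to it. -/
theorem mem_graph_of_forall_inner {A : ℋ →ₗ.[ℂ] ℋ} (hA : IsSelfAdjoint A) {v w : ℋ}
    (h : ∀ x y, (x, y) ∈ A.graph → ⟪v, y⟫_ℂ = ⟪w, x⟫_ℂ) : (v, w) ∈ A.graph := by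
  have hv : v ∈ A.adjoint.domain := A.mem_adjoint_domain_of_exists v
    ⟨w, fun x => (h _ _ (A.mem_graph x)).symm⟩
  have h2 : A.adjoint ⟨v, hv⟩ = w :=
    A.adjoint_apply_eq hA.dense_domain ⟨v, hv⟩ fun x => (h _ _ (A.mem_graph x)).symm
  have h3 : (v, A.adjoint ⟨v, hv⟩) ∈ A.adjoint.graph := A.adjoint.mem_graph ⟨v, hv⟩
  rw [h2] at h3
  rwa [LinearPMap.isSelfAdjoint_def.1 hA] at h3

/-- If `A` is self-adjoint and both `A - z` and `A - z̄` are bounded below, then `A - z` has an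
everywhere defined bounded inverse: its range is closed, and a vector orthogonal to the range
lies in the kernel of `A - z̄`. -/
theorem exists_resolvent {A : ℋ →ₗ.[ℂ] ℋ} (hA : IsSelfAdjoint A) (z : ℂ) {c : ℝ} (hc : 0 < c)
    (h : ∀ x y, (x, y) ∈ A.graph → c * ‖x‖ ≤ ‖y - z • x‖)
    (h' : ∀ x y, (x, y) ∈ A.graph → c * ‖x‖ ≤ ‖y - (starRingEnd ℂ) z • x‖) :
    ∃ B : ℋ →L[ℂ] ℋ, ∀ x y, (x, y + z • x) ∈ A.graph ↔ x = B y := by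
  have hclosed : IsClosed (A.graph : Set (ℋ × ℋ)) := hA.isClosed
  have : CompleteSpace A.graph := hclosed.completeSpace_coe
  let L : A.graph →L[ℂ] ℋ :=
    (ContinuousLinearMap.snd ℂ ℋ ℋ - z • ContinuousLinearMap.fst ℂ ℋ ℋ).comp A.graph.subtypeL
  have hL : ∀ p : A.graph, L p = (p : ℋ × ℋ).2 - z • (p : ℋ × ℋ).1 := fun p => rfl
  have hlow : ∀ p : A.graph, ‖p‖ ≤ ((1 + ‖z‖ / c + 1 / c : ℝ)) * ‖L p‖ := by
    intro p
    have h1 : c * ‖(p : ℋ × ℋ).1‖ ≤ ‖L p‖ := h _ _ p.2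
    have h2 : ‖(p : ℋ × ℋ).1‖ ≤ ‖L p‖ / c := by
      rw [le_div_iff₀ hc, mul_comm]; exact h1
    have h3 : ‖(p : ℋ × ℋ).2‖ ≤ ‖L p‖ + ‖z‖ * (‖L p‖ / c) := by
      have : (p : ℋ × ℋ).2 = L p + z • (p : ℋ × ℋ).1 := by rw [hL]; abel
      rw [this]
      refine (norm_add_le _ _).trans ?_
      rw [norm_smul]
      gcongr
    have h4 : 0 ≤ ‖z‖ * (‖L p‖ / c) := by positivity
    have h5 : 0 ≤ ‖L p‖ / c := by positivity
    have h6 : (1 + ‖z‖ / c + 1 / c : ℝ) * ‖L p‖ =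
        ‖L p‖ + ‖z‖ * (‖L p‖ / c) + ‖L p‖ / c := by ring
    rw [h6]
    change max ‖(p : ℋ × ℋ).1‖ ‖(p : ℋ × ℋ).2‖ ≤ _
    refine max_le ?_ ?_
    · linarith [norm_nonneg (L p)]
    · linarith
  have hanti : AntilipschitzWith (Real.toNNReal (1 + ‖z‖ / c + 1 / c)) L :=
    ContinuousLinearMap.antilipschitz_of_bound L fun p => by
      rw [Real.coe_toNNReal _ (by positivity)]; exact hlow p
  have hker : L.ker = ⊥ := LinearMap.ker_eq_bot.2 hanti.injective
  have hrc : IsClosed (L.range : Set ℋ) := by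
    have h0 := hanti.isClosed_range L.uniformContinuous
    exact h0
  have hrange : L.range = ⊤ := by
    have : CompleteSpace L.range := hrc.completeSpace_coe
    rw [← Submodule.orthogonal_eq_bot_iff, Submodule.eq_bot_iff]
    intro v hv
    have hmem : (v, (starRingEnd ℂ) z • v) ∈ A.graph := by
      refine mem_graph_of_forall_inner hA fun x y hxy => ?_
      have h1 : ⟪L ⟨(x, y), hxy⟩, v⟫_ℂ = 0 := hv _ ⟨⟨(x, y), hxy⟩, rfl⟩
      have h2 : ⟪v, y⟫_ℂ - z * ⟪v, x⟫_ℂ = 0 := by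
        rw [← inner_smul_right, ← inner_sub_right]
        exact inner_eq_zero_symm.1 h1
      rw [inner_smul_left, Complex.conj_conj]
      exact sub_eq_zero.1 h2
    have h1 := h' _ _ hmem
    rw [sub_self, norm_zero] at h1
    exact norm_le_zero_iff.1 (nonpos_of_mul_nonpos_right h1 hc)
  let e := ContinuousLinearEquiv.ofBijective L hker hrange
  refine ⟨(ContinuousLinearMap.fst ℂ ℋ ℋ).comp (A.graph.subtypeL.comp
    (e.symm : ℋ →L[ℂ] A.graph)), fun x y => ⟨fun hxy => ?_, ?_⟩⟩
  · have h1 : e ⟨(x, y + z • x), hxy⟩ = y := by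
      change L _ = y
      rw [hL]
      simp
    change x = ((e.symm y : A.graph) : ℋ × ℋ).1
    rw [← h1, e.symm_apply_apply]
  · intro hx
    have hx' : x = ((e.symm y : A.graph) : ℋ × ℋ).1 := hx
    have h1 : L (e.symm y) = y := e.apply_symm_apply y
    have h2 : y + z • x = ((e.symm y : A.graph) : ℋ × ℋ).2 := by
      rw [hL] at h1
      rw [hx', ← eq_sub_iff_add_eq]
      exact h1.symm
    rw [h2, hx']
    exact (e.symm y).2

/-- A self-adjoint operator with a strictly positive lower bound has a bounded inverse. -/
theorem exists_isBoundedInverse {A : ℋ →ₗ.[ℂ] ℋ} (hA : IsSelfAdjoint A) {c : ℝ} (hc : 0 < c)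
    (h : ∀ x y, (x, y) ∈ A.graph → c * ‖x‖ ≤ ‖y‖) : ∃ B, IsBoundedInverse A B := by
  obtain ⟨B, hB⟩ := exists_resolvent hA 0 hc (fun x y hxy => by simpa using h x y hxy)
    (fun x y hxy => by simpa using h x y hxy)
  exact ⟨B, fun x y => by simpa using hB x y⟩

end Resolvent

/-! ### Half-integer powers -/

section HalfPowers

theorem injective_pow_of_mul_self {r B : ℋ →L[ℂ] ℋ} (h : r * r = B)
    (hB : Function.Injective B) (q : ℕ) : Function.Injective (r ^ q : ℋ →L[ℂ] ℋ) := by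
  have h1 : Function.Injective r := by
    intro x y hxy
    apply hB
    rw [← h, mul_apply_eq_comp, mul_apply_eq_comp, hxy]
  induction q with
  | zero => exact fun x y hxy => hxy
  | succ q ih =>
    intro x y hxy
    rw [pow_succ] at hxy
    exact h1 (ih hxy)

variable [CompleteSpace ℋ]

theorem invSqrt_nonneg (A : ℋ →ₗ.[ℂ] ℋ) : 0 ≤ invSqrt A := CFC.sqrt_nonneg _

theorem isSelfAdjoint_invSqrt (A : ℋ →ₗ.[ℂ] ℋ) : IsSelfAdjoint (invSqrt A) :=
  (invSqrt_nonneg A).isSelfAdjoint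

theorem invSqrt_mul_self {A : ℋ →ₗ.[ℂ] ℋ} {B : ℋ →L[ℂ] ℋ} (hB : IsBoundedInverse A B)
    (h0 : 0 ≤ B) : invSqrt A * invSqrt A = B := by
  rw [invSqrt, hB.inv_eq]
  exact CFC.sqrt_mul_sqrt_self B h0

theorem inner_pow_left {r : ℋ →L[ℂ] ℋ} (hr : IsSelfAdjoint r) (q : ℕ) (x y : ℋ) :
    ⟪(r ^ q) x, y⟫_ℂ = ⟪x, (r ^ q) y⟫_ℂ :=
  (hr.pow q).isSymmetric x y

theorem norm_sq_pow_apply {r : ℋ →L[ℂ] ℋ} (hr : IsSelfAdjoint r) (q : ℕ) (x : ℋ) :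
    ‖(r ^ q) x‖ ^ 2 = (⟪x, ((r * r) ^ q) x⟫_ℂ).re := by
  rw [← pow_two r, ← pow_mul, mul_comm, mul_comm q 2, two_mul, pow_add,
    mul_apply_eq_comp, ← inner_pow_left hr, ← @inner_self_eq_norm_sq ℂ]
  rfl

/-- The range of an injective self-adjoint bounded operator is dense. -/
theorem dense_range_of_selfAdjoint_injective {T : ℋ →L[ℂ] ℋ} (hT : IsSelfAdjoint T)
    (hi : Function.Injective T) : Dense (Set.range T) := by
  have h : (T.range).topologicalClosure = ⊤ := by
    rw [Submodule.topologicalClosure_eq_top_iff, Submodule.eq_bot_iff]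
    intro v hv
    have h1 : ⟪T (T v), v⟫_ℂ = 0 := hv _ ⟨T v, rfl⟩
    have h2 : ⟪T v, T v⟫_ℂ = 0 := by
      rw [← h1]
      exact (hT.isSymmetric (T v) v).symm
    exact hi (by rw [inner_self_eq_zero.1 h2, map_zero])
  have h2 := Submodule.dense_iff_topologicalClosure_eq_top.2 h
  exact h2

theorem mem_graph_halfPow_neg {A : ℋ →ₗ.[ℂ] ℋ} {q : ℕ} {x y : ℋ} :
    (x, y) ∈ (halfPow A (-(q : ℤ))).graph ↔ y = (invSqrt A ^ q) x := by
  rw [halfPow, if_pos (by omega), mem_graph_ofBounded, Int.natAbs_neg, Int.natAbs_natCast]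

theorem mem_graph_halfPow {A : ℋ →ₗ.[ℂ] ℋ} {B : ℋ →L[ℂ] ℋ} (hB : IsBoundedInverse A B)
    (h0 : 0 ≤ B) {q : ℕ} {x y : ℋ} :
    (x, y) ∈ (halfPow A (q : ℤ)).graph ↔ x = (invSqrt A ^ q) y := by
  rcases Nat.eq_zero_or_pos q with rfl | hq
  · have := @mem_graph_halfPow_neg ℋ _ _ _ A 0 x y
    simp only [Nat.cast_zero, neg_zero, pow_zero, one_apply_eq_self] at this ⊢
    rw [this, eq_comm]
  · have hinj := injective_pow_of_mul_self (invSqrt_mul_self hB h0) hB.injective q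
    have hker : LinearMap.ker (ofBounded (invSqrt A ^ q)).toFun = ⊥ := by
      rw [LinearMap.ker_eq_bot]
      intro u v huv
      exact Subtype.ext (hinj huv)
    rw [halfPow, if_neg (by omega), Int.natAbs_natCast, LinearPMap.inverse_graph hker,
      Submodule.mem_map]
    constructor
    · rintro ⟨⟨u, v⟩, huv, h⟩
      have h1 : v = x := congrArg Prod.fst h
      have h2 : u = y := congrArg Prod.snd h
      rw [← h1, ← h2]
      exact mem_graph_ofBounded.1 huv
    · rintro rfl
      exact ⟨(y, _), mem_graph_ofBounded.2 rfl, rfl⟩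

theorem mem_domain_halfPow {A : ℋ →ₗ.[ℂ] ℋ} {B : ℋ →L[ℂ] ℋ} (hB : IsBoundedInverse A B)
    (h0 : 0 ≤ B) {q : ℕ} {x : ℋ} :
    x ∈ (halfPow A (q : ℤ)).domain ↔ ∃ y, (invSqrt A ^ q) y = x := by
  rw [mem_domain_iff_graph]
  simp only [mem_graph_halfPow hB h0, eq_comm]

theorem dense_domain_halfPow {A : ℋ →ₗ.[ℂ] ℋ} {B : ℋ →L[ℂ] ℋ} (hB : IsBoundedInverse A B)
    (h0 : 0 ≤ B) (n : ℤ) : Dense ((halfPow A n).domain : Set ℋ) := by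
  obtain ⟨q, rfl | rfl⟩ := n.eq_nat_or_neg
  · have h := dense_range_of_selfAdjoint_injective ((isSelfAdjoint_invSqrt A).pow q)
      (injective_pow_of_mul_self (invSqrt_mul_self hB h0) hB.injective q)
    refine h.mono ?_
    rintro _ ⟨y, rfl⟩
    exact (mem_domain_halfPow hB h0).2 ⟨y, rfl⟩
  · refine dense_univ.mono fun x _ => mem_domain_iff_graph.2 ⟨_, mem_graph_halfPow_neg.2 rfl⟩

/-! ### Unitary conjugation -/

theorem unitary_star_apply_apply (W : unitary (ℋ →L[ℂ] ℋ)) (x : ℋ) :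
    ((star W : unitary (ℋ →L[ℂ] ℋ)) : ℋ →L[ℂ] ℋ) ((W : ℋ →L[ℂ] ℋ) x) = x := by
  have h := Unitary.star_mul_self_of_mem W.2
  exact congrArg (fun T : ℋ →L[ℂ] ℋ => T x) h

theorem unitary_apply_star_apply (W : unitary (ℋ →L[ℂ] ℋ)) (x : ℋ) :
    (W : ℋ →L[ℂ] ℋ) (((star W : unitary (ℋ →L[ℂ] ℋ)) : ℋ →L[ℂ] ℋ) x) = x := by
  have h := Unitary.mul_star_self_of_mem W.2
  exact congrArg (fun T : ℋ →L[ℂ] ℋ => T x) h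

theorem norm_unitary_apply (W : unitary (ℋ →L[ℂ] ℋ)) (x : ℋ) : ‖(W : ℋ →L[ℂ] ℋ) x‖ = ‖x‖ :=
  ContinuousLinearMap.norm_map_of_mem_unitary W.2 x

theorem mem_graph_conj {W : unitary (ℋ →L[ℂ] ℋ)} {A : ℋ →ₗ.[ℂ] ℋ} {x y : ℋ} :
    (x, y) ∈ (conj W A).graph ↔
      (((star W : unitary (ℋ →L[ℂ] ℋ)) : ℋ →L[ℂ] ℋ) x,
        ((star W : unitary (ℋ →L[ℂ] ℋ)) : ℋ →L[ℂ] ℋ) y) ∈ A.graph := by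
  simp only [conj, mem_graph_comp, mem_graph_ofBounded]
  constructor
  · rintro ⟨_, ⟨_, rfl, h⟩, rfl⟩
    rwa [unitary_star_apply_apply]
  · intro h
    exact ⟨_, ⟨_, rfl, h⟩, (unitary_apply_star_apply W y).symm⟩

theorem IsBoundedInverse.conj {A : ℋ →ₗ.[ℂ] ℋ} {B : ℋ →L[ℂ] ℋ} (hB : IsBoundedInverse A B)
    (W : unitary (ℋ →L[ℂ] ℋ)) :
    IsBoundedInverse (conj W A)
      ((W : ℋ →L[ℂ] ℋ) * B * ((star W : unitary (ℋ →L[ℂ] ℋ)) : ℋ →L[ℂ] ℋ)) := by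
  intro x y
  rw [mem_graph_conj, hB]
  constructor
  · intro h
    rw [mul_apply_eq_comp, mul_apply_eq_comp, ← h,
      unitary_apply_star_apply]
  · rintro rfl
    rw [mul_apply_eq_comp, mul_apply_eq_comp, unitary_star_apply_apply]

theorem conj_bounded_nonneg {B : ℋ →L[ℂ] ℋ} (h0 : 0 ≤ B) (W : unitary (ℋ →L[ℂ] ℋ)) :
    0 ≤ (W : ℋ →L[ℂ] ℋ) * B * ((star W : unitary (ℋ →L[ℂ] ℋ)) : ℋ →L[ℂ] ℋ) :=
  star_right_conjugate_nonneg h0 (W : ℋ →L[ℂ] ℋ)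

theorem invSqrt_conj_pow {A : ℋ →ₗ.[ℂ] ℋ} {B : ℋ →L[ℂ] ℋ} (hB : IsBoundedInverse A B)
    (h0 : 0 ≤ B) (W : unitary (ℋ →L[ℂ] ℋ)) (q : ℕ) :
    invSqrt (conj W A) ^ q =
      (W : ℋ →L[ℂ] ℋ) * invSqrt A ^ q * ((star W : unitary (ℋ →L[ℂ] ℋ)) : ℋ →L[ℂ] ℋ) := by
  have hW : ((star W : unitary (ℋ →L[ℂ] ℋ)) : ℋ →L[ℂ] ℋ) * (W : ℋ →L[ℂ] ℋ) = 1 :=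
    Unitary.star_mul_self_of_mem W.2
  have hW' : (W : ℋ →L[ℂ] ℋ) * ((star W : unitary (ℋ →L[ℂ] ℋ)) : ℋ →L[ℂ] ℋ) = 1 :=
    Unitary.mul_star_self_of_mem W.2
  have h1 : invSqrt (conj W A) =
      (W : ℋ →L[ℂ] ℋ) * invSqrt A * ((star W : unitary (ℋ →L[ℂ] ℋ)) : ℋ →L[ℂ] ℋ) := by
    rw [invSqrt, (hB.conj W).inv_eq]
    refine (CFC.sqrt_eq_iff _ _ (conj_bounded_nonneg h0 W)
      (conj_bounded_nonneg (invSqrt_nonneg A) W)).2 ?_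
    rw [← invSqrt_mul_self hB h0]
    simp only [mul_assoc]
    rw [← mul_assoc _ (W : ℋ →L[ℂ] ℋ), hW, one_mul]
  rw [h1]
  induction q with
  | zero => rw [pow_zero, pow_zero, mul_one, hW']
  | succ q ih =>
    rw [pow_succ, ih, pow_succ]
    simp only [mul_assoc]
    rw [← mul_assoc _ (W : ℋ →L[ℂ] ℋ), hW, one_mul]

theorem norm_invSqrt_conj_pow_apply {A : ℋ →ₗ.[ℂ] ℋ} {B : ℋ →L[ℂ] ℋ}
    (hB : IsBoundedInverse A B) (h0 : 0 ≤ B) (W : unitary (ℋ →L[ℂ] ℋ)) (q : ℕ) (x : ℋ) :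
    ‖(invSqrt (conj W A) ^ q) x‖ =
      ‖(invSqrt A ^ q) (((star W : unitary (ℋ →L[ℂ] ℋ)) : ℋ →L[ℂ] ℋ) x)‖ := by
  rw [invSqrt_conj_pow hB h0, mul_apply_eq_comp, mul_apply_eq_comp,
    norm_unitary_apply]

end HalfPowers

/-! ### The resolvent at zero of a perturbed operator -/

section Perturbation

/-- `R (1 + λ B)⁻¹`. When `R = H₀⁻¹` and `B = H₁ H₀⁻¹` this is `(H₀ + λ H₁)⁻¹`, and
`neumann B B λ` is `H₁ (H₀ + λ H₁)⁻¹`. -/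
def neumann (R B : ℋ →L[ℂ] ℋ) (l : ℝ) : ℋ →L[ℂ] ℋ := R * Ring.inverse (1 + (l : ℂ) • B)

theorem mem_graph_neumann {H₁ : ℋ →ₗ.[ℂ] ℋ} {R B : ℋ →L[ℂ] ℋ} {l : ℝ}
    (hB : ∀ y, (R y, B y) ∈ H₁.graph) (y : ℋ) :
    (neumann R B l y, neumann B B l y) ∈ H₁.graph :=
  hB _

variable [CompleteSpace ℋ]

theorem isUnit_one_add_of_norm_lt_one {T : ℋ →L[ℂ] ℋ} (h : ‖T‖ < 1) : IsUnit (1 + T) := by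
  have := isUnit_one_sub_of_norm_lt_one (x := -T) (by rwa [norm_neg])
  rwa [sub_neg_eq_add] at this

/-- Multiplying a positive operator `R` by the inverse of `1 + B`, `‖B‖ < 1`, gives a positive
operator as soon as the product is self-adjoint. Indeed `1 + c R (1 + B)⁻¹` is invertible for
`c > 0`, because so is `1 + B + c R = (1 + B (1 + c R)⁻¹) (1 + c R)`. -/
theorem nonneg_mul_inverse_one_add {R B : ℋ →L[ℂ] ℋ} (hR : 0 ≤ R) (hB : ‖B‖ < 1)
    (hsa : IsSelfAdjoint (R * Ring.inverse (1 + B))) : 0 ≤ R * Ring.inverse (1 + B) := by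
  have key : ∀ c : ℝ, 0 < c → IsUnit (1 + (c : ℂ) • (R * Ring.inverse (1 + B))) := by
    intro c hc
    have hcR : (0 : ℋ →L[ℂ] ℋ) ≤ (c : ℂ) • R := by
      have h1 : (c : ℂ) • R = c • R := by
        ext x; simp
      rw [h1]
      exact smul_nonneg hc.le hR
    have hu : IsUnit (1 + (c : ℂ) • R) :=
      CStarAlgebra.isUnit_of_le 1 (le_add_of_nonneg_right hcR)
    have hlow : ∀ x, ‖x‖ ≤ ‖(1 + (c : ℂ) • R) x‖ := by
      intro x
      rcases (norm_nonneg x).eq_or_lt with h0 | h0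
      · rw [← h0]; exact norm_nonneg _
      have hpos : 0 ≤ (⟪x, ((c : ℂ) • R) x⟫_ℂ).re :=
        ((ContinuousLinearMap.nonneg_iff_isPositive _).1 hcR).re_inner_nonneg_right x
      have h2 : ‖x‖ * ‖x‖ ≤ ‖x‖ * ‖(1 + (c : ℂ) • R) x‖ := by
        refine le_trans ?_ ((Complex.re_le_norm _).trans (norm_inner_le_norm (𝕜 := ℂ) x _))
        have h3 : (1 + (c : ℂ) • R) x = x + ((c : ℂ) • R) x := rfl
        rw [h3, inner_add_right, Complex.add_re]
        have h4 : (⟪x, x⟫_ℂ).re = ‖x‖ * ‖x‖ := inner_self_eq_norm_mul_norm (𝕜 := ℂ) x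
        linarith
      exact le_of_mul_le_mul_left h2 h0
    have hP : ‖Ring.inverse (1 + (c : ℂ) • R)‖ ≤ 1 := by
      refine ContinuousLinearMap.opNorm_le_bound _ zero_le_one fun y => ?_
      have h1 := hlow (Ring.inverse (1 + (c : ℂ) • R) y)
      rwa [← mul_apply_eq_comp, Ring.mul_inverse_cancel _ hu, one_apply_eq_self, ← one_mul ‖y‖]
        at h1
    have hu2 : IsUnit (1 + B * Ring.inverse (1 + (c : ℂ) • R)) := by
      refine isUnit_one_add_of_norm_lt_one ((norm_mul_le _ _).trans_lt ?_)
      calc ‖B‖ * ‖Ring.inverse (1 + (c : ℂ) • R)‖ ≤ ‖B‖ * 1 := by gcongr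
        _ < 1 := by rwa [mul_one]
    have huB : IsUnit (1 + B) := isUnit_one_add_of_norm_lt_one hB
    have hprod : (1 + B * Ring.inverse (1 + (c : ℂ) • R)) * (1 + (c : ℂ) • R) =
        (1 + (c : ℂ) • (R * Ring.inverse (1 + B))) * (1 + B) := by
      rw [add_mul, mul_assoc B, Ring.inverse_mul_cancel _ hu, add_mul, smul_mul_assoc,
        mul_assoc R, Ring.inverse_mul_cancel _ huB]
      simp only [one_mul, mul_one]
      abel
    have h5 := hu2.mul hu
    rw [hprod] at h5
    have h6 := h5.mul (huB.unit⁻¹).isUnit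
    rwa [mul_assoc, IsUnit.mul_val_inv, mul_one] at h6
  rw [StarOrderedRing.nonneg_iff_spectrum_nonneg (R := ℝ) _ hsa]
  intro t ht
  by_contra hneg
  push Not at hneg
  apply ht
  have h1 := key (-t)⁻¹ (inv_pos.2 (by linarith))
  have ht0 : (t : ℂ) ≠ 0 := by exact_mod_cast hneg.ne
  have h2 : algebraMap ℝ (ℋ →L[ℂ] ℋ) t - R * Ring.inverse (1 + B) =
      (Units.mk0 (t : ℂ) ht0) • (1 + (((-t)⁻¹ : ℝ) : ℂ) • (R * Ring.inverse (1 + B))) := by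
    rw [Units.smul_def, Units.val_mk0, smul_add, smul_smul, Algebra.algebraMap_eq_smul_one]
    have h3 : (t : ℂ) * (((-t)⁻¹ : ℝ) : ℂ) = -1 := by
      push_cast
      field_simp
    have h4 : t • (1 : ℋ →L[ℂ] ℋ) = (t : ℂ) • 1 := by
      ext x; simp
    rw [h3, h4, neg_smul, one_smul, sub_eq_add_neg]
  rw [spectrum.mem_resolventSet_iff, h2]
  exact h1.smul _

theorem hasDerivAt_neumann {R B : ℋ →L[ℂ] ℋ} {l : ℝ} (h : ‖(l : ℂ) • B‖ < 1) :
    HasDerivAt (neumann R B) (-(neumann R B l * neumann B B l)) l := by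
  have hu := isUnit_one_add_of_norm_lt_one h
  have h1 : HasDerivAt (fun l : ℝ => (1 : ℋ →L[ℂ] ℋ) + (l : ℂ) • B) B l := by
    have h2 : HasDerivAt (fun l : ℝ => (l : ℂ)) 1 l := Complex.ofRealCLM.hasDerivAt
    simpa using (h2.smul_const B).const_add 1
  have h3 := hasFDerivAt_ringInverse (𝕜 := ℝ) hu.unit
  have h4 := (h3.comp_hasDerivAt_of_eq l h1 rfl).const_mul R
  convert! h4 using 1
  have h5 : (↑(hu.unit)⁻¹ : ℋ →L[ℂ] ℋ) = Ring.inverse (1 + (l : ℂ) • B) := by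
    rw [← Ring.inverse_unit]; rfl
  simp only [neumann, neg_apply, ContinuousLinearMap.mulLeftRight_apply, h5,
    mul_neg, mul_assoc]

variable {H₀ H₁ : ℋ →ₗ.[ℂ] ℋ} {R B : ℋ →L[ℂ] ℋ} {l : ℝ}

theorem neumann_one_add (h : ‖(l : ℂ) • B‖ < 1) (T : ℋ →L[ℂ] ℋ) (v : ℋ) :
    neumann T B l (v + (l : ℂ) • B v) = T v := by
  have hu := isUnit_one_add_of_norm_lt_one h
  have h1 : v + (l : ℂ) • B v = (1 + (l : ℂ) • B) v := rfl
  rw [h1, ← mul_apply_eq_comp, neumann, mul_assoc, Ring.inverse_mul_cancel _ hu, mul_one]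

theorem exists_eq_one_add (h : ‖(l : ℂ) • B‖ < 1) (w : ℋ) : ∃ v, v + (l : ℂ) • B v = w := by
  have hu := isUnit_one_add_of_norm_lt_one h
  refine ⟨Ring.inverse (1 + (l : ℂ) • B) w, ?_⟩
  have h1 : ∀ v, v + (l : ℂ) • B v = (1 + (l : ℂ) • B) v := fun _ => rfl
  rw [h1, ← mul_apply_eq_comp, Ring.mul_inverse_cancel _ hu, one_apply_eq_self]

theorem isBoundedInverse_neumann (hR : IsBoundedInverse H₀ R)
    (hB : ∀ y, (R y, B y) ∈ H₁.graph) (h : ‖(l : ℂ) • B‖ < 1) :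
    IsBoundedInverse (H₀ + (l : ℂ) • H₁) (neumann R B l) := by
  intro x y
  rw [mem_graph_perturbation]
  constructor
  · rintro ⟨u, v, hu, hv, rfl⟩
    obtain rfl := (hR _ _).1 hu
    obtain rfl := graph_unique (hB u) hv
    exact (neumann_one_add h R u).symm
  · rintro rfl
    obtain ⟨v, rfl⟩ := exists_eq_one_add h y
    rw [neumann_one_add h]
    exact ⟨v, B v, hR.mem_graph v, hB v, rfl⟩

theorem inner_neumann_comm (hB : ∀ y, (R y, B y) ∈ H₁.graph) (h₁ : IsSelfAdjoint H₁) (x y : ℋ) :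
    ⟪neumann R B l x, neumann B B l y⟫_ℂ = ⟪neumann B B l x, neumann R B l y⟫_ℂ :=
  graph_symmetric h₁ (mem_graph_neumann hB x) (mem_graph_neumann hB y)

theorem isSelfAdjoint_of_isBoundedInverse (h₀ : IsSelfAdjoint H₀) (hR : IsBoundedInverse H₀ R) :
    IsSelfAdjoint R := by
  rw [ContinuousLinearMap.isSelfAdjoint_iff_isSymmetric]
  exact fun x y => graph_symmetric h₀ (hR.mem_graph x) (hR.mem_graph y) ▸ rfl

theorem isSelfAdjoint_neumann (hR : IsBoundedInverse H₀ R)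
    (hB : ∀ y, (R y, B y) ∈ H₁.graph) (h₀ : IsSelfAdjoint H₀) (h₁ : IsSelfAdjoint H₁)
    (h : ‖(l : ℂ) • B‖ < 1) : IsSelfAdjoint (neumann R B l) := by
  rw [ContinuousLinearMap.isSelfAdjoint_iff_isSymmetric]
  intro x y
  have hx := (isBoundedInverse_neumann hR hB h).mem_graph x
  have hy := (isBoundedInverse_neumann hR hB h).mem_graph y
  obtain ⟨u, v, hu, hv, hx'⟩ := mem_graph_perturbation.1 hx
  obtain ⟨u', v', hu', hv', hy'⟩ := mem_graph_perturbation.1 hy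
  change ⟪neumann R B l x, y⟫_ℂ = ⟪x, neumann R B l y⟫_ℂ
  conv_lhs => rw [hy']
  conv_rhs => rw [hx']
  rw [inner_add_right, inner_add_left, inner_smul_left, inner_smul_right, Complex.conj_ofReal,
    graph_symmetric h₀ hu hu', graph_symmetric h₁ hv hv']

theorem neumann_nonneg (hR : IsBoundedInverse H₀ R)
    (hB : ∀ y, (R y, B y) ∈ H₁.graph) (h₀ : IsSelfAdjoint H₀) (h₁ : IsSelfAdjoint H₁)
    (hpos : 0 ≤ R) (h : ‖(l : ℂ) • B‖ < 1) : 0 ≤ neumann R B l :=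
  nonneg_mul_inverse_one_add hpos h (isSelfAdjoint_neumann hR hB h₀ h₁ h)

/-- The perturbed operator is bounded below by `1` when the bound of `l H₁` relative to `H₀` is
small compared with the gap. -/
theorem norm_neumann_le {δ c : ℝ} (hδ : ‖(l : ℂ) • B‖ ≤ δ) (hδ1 : δ < 1)
    (hRc : ∀ y, c * ‖R y‖ ≤ ‖y‖) (hcδ : 1 ≤ (1 - δ) * c) (y : ℋ) :
    ‖neumann R B l y‖ ≤ ‖y‖ := by
  obtain ⟨v, rfl⟩ := exists_eq_one_add (hδ.trans_lt hδ1) y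
  rw [neumann_one_add (hδ.trans_lt hδ1)]
  have h1 : ‖(l : ℂ) • B v‖ ≤ δ * ‖v‖ := ((l : ℂ) • B).le_of_opNorm_le hδ v
  have h2 : ‖v‖ ≤ ‖v + (l : ℂ) • B v‖ + ‖(l : ℂ) • B v‖ := by
    have := norm_sub_le (v + (l : ℂ) • B v) ((l : ℂ) • B v)
    rwa [add_sub_cancel_right] at this
  have h3 : (1 - δ) * ‖v‖ ≤ ‖v + (l : ℂ) • B v‖ := by linarith
  calc ‖R v‖ ≤ ((1 - δ) * c) * ‖R v‖ := le_mul_of_one_le_left (norm_nonneg _) hcδ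
    _ = (1 - δ) * (c * ‖R v‖) := by ring
    _ ≤ (1 - δ) * ‖v‖ := mul_le_mul_of_nonneg_left (hRc v) (by linarith)
    _ ≤ _ := h3

end Perturbation

/-! ### Bounds for the logarithmic derivative of the powers -/

section PowerBounds

variable [CompleteSpace ℋ]

/-- The bound of `H₁` relative to `H₀^{1/2}` carries over to `(H₀ + l H₁)^{1/2}`. With
`x = (H₀ + l H₁)⁻¹ w`, the numbers `p = ‖H₀^{1/2} x‖` and `q = ‖(H₀ + l H₁)^{1/2} x‖` satisfy
`p² ≤ q² + |l| N p q`, hence `p ≤ (1 + |l| N) q`. -/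
theorem norm_neumann_le_rel {R B r₀ r : ℋ →L[ℂ] ℋ} {l a b N : ℝ} (ha : 0 ≤ a) (hb : 0 ≤ b)
    (hN : 0 ≤ N) (hr₀ : IsSelfAdjoint r₀) (hr₀R : r₀ * r₀ = R) (hr : IsSelfAdjoint r)
    (hrR : r * r = neumann R B l) (hr1 : ∀ x, ‖r x‖ ≤ ‖x‖) (hl : ‖(l : ℂ) • B‖ < 1)
    (hrel : ∀ v, ‖B v‖ ≤ a * ‖r₀ v‖ + b * ‖R v‖) (hBN : ∀ v, ‖B v‖ ≤ N * ‖r₀ v‖) (w : ℋ) :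
    ‖neumann B B l w‖ ≤ (a * (1 + |l| * N) + b) * ‖r w‖ := by
  obtain ⟨v, hv⟩ := exists_eq_one_add hl w
  have hRw : neumann R B l w = R v := by rw [← hv, neumann_one_add hl]
  have hBw : neumann B B l w = B v := by rw [← hv, neumann_one_add hl]
  have hRv : ‖R v‖ ≤ ‖r w‖ := by
    rw [← hRw, ← hrR]
    exact hr1 _
  have hq : ‖r w‖ ^ 2 = (⟪w, R v⟫_ℂ).re := by
    have := norm_sq_pow_apply hr 1 w
    rwa [pow_one, pow_one, hrR, hRw] at this
  have hp : ‖r₀ v‖ ^ 2 = (⟪v, R v⟫_ℂ).re := by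
    have := norm_sq_pow_apply hr₀ 1 v
    rwa [pow_one, pow_one, hr₀R] at this
  have hquad : ‖r₀ v‖ ^ 2 ≤ ‖r w‖ ^ 2 + |l| * N * ‖r₀ v‖ * ‖r w‖ := by
    have h1 : v = w - (l : ℂ) • B v := by rw [← hv]; abel
    have h2 : ⟪v, R v⟫_ℂ = ⟪w, R v⟫_ℂ - ⟪(l : ℂ) • B v, R v⟫_ℂ := by
      rw [← inner_sub_left, ← h1]
    have h3 : -(⟪(l : ℂ) • B v, R v⟫_ℂ).re ≤ |l| * N * ‖r₀ v‖ * ‖r w‖ := by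
      refine (neg_le_abs _).trans ((Complex.abs_re_le_norm _).trans
        ((norm_inner_le_norm _ _).trans ?_))
      rw [norm_smul, Complex.norm_real, Real.norm_eq_abs]
      have := hBN v
      calc |l| * ‖B v‖ * ‖R v‖ ≤ |l| * (N * ‖r₀ v‖) * ‖r w‖ := by gcongr
        _ = _ := by ring
    rw [hp, hq, h2, Complex.sub_re]
    linarith
  have hlN : 0 ≤ |l| * N := mul_nonneg (abs_nonneg l) hN
  have hpq : ‖r₀ v‖ ≤ (1 + |l| * N) * ‖r w‖ := by
    by_contra! hlt
    have h0 := norm_nonneg (r w)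
    have h1 : ‖r w‖ ≤ ‖r₀ v‖ := by nlinarith
    have h2 : 0 < ‖r₀ v‖ := lt_of_le_of_lt (by positivity) hlt
    have h3 : 0 < ‖r₀ v‖ * (‖r₀ v‖ - (1 + |l| * N) * ‖r w‖) := mul_pos h2 (by linarith)
    have h4 : 0 ≤ ‖r w‖ * (‖r₀ v‖ - ‖r w‖) := mul_nonneg h0 (by linarith)
    have h5 : ‖r₀ v‖ * (‖r₀ v‖ - (1 + |l| * N) * ‖r w‖) + ‖r w‖ * (‖r₀ v‖ - ‖r w‖) =
        ‖r₀ v‖ ^ 2 - (‖r w‖ ^ 2 + |l| * N * ‖r₀ v‖ * ‖r w‖) := by ring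
    linarith
  rw [hBw]
  calc ‖B v‖ ≤ a * ‖r₀ v‖ + b * ‖R v‖ := hrel v
    _ ≤ a * ((1 + |l| * N) * ‖r w‖) + b * ‖r w‖ := by gcongr
    _ = _ := by ring

variable {r R B : ℋ →L[ℂ] ℋ} {c : ℝ} {e : ℕ → ℝ} {m : ℕ}

/-- With `R = H⁻¹`, `r = H^{-1/2}` and `B = H₁ H⁻¹`: the operator `H^{-q/2} H₁ H^{(q-2)/2}` is
bounded, by induction on `q` in steps of two. The step commutes one factor `H⁻¹` through `H₁`, at
the expense of the commutator `R B - B R = H⁻¹ [H₁, H] H⁻²`. -/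
theorem norm_pow_mul_le (hr : IsSelfAdjoint r) (hrR : r * r = R) (hr1 : ∀ x, ‖r x‖ ≤ ‖x‖)
    (hc : 0 ≤ c) (hB : ∀ w, ‖B w‖ ≤ c * ‖r w‖)
    (hsymm : ∀ x y, ⟪R x, B y⟫_ℂ = ⟪B x, R y⟫_ℂ)
    (he : ∀ k, 1 ≤ k → k ≤ m → 0 ≤ e k)
    (hcomm : ∀ q, 1 ≤ q → q + 2 ≤ m → ∀ w,
      ‖(r ^ q) (R (B w) - B (R w))‖ ≤ e (q + 2) * ‖(r ^ (q + 4)) w‖) :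
    ∀ q, 1 ≤ q → q ≤ m → ∀ w,
      ‖(r ^ q) (B w)‖ ≤ (c + ∑ k ∈ Finset.Icc 1 q, e k) * ‖(r ^ q) w‖ := by
  have hRs : ∀ x y, ⟪R x, y⟫_ℂ = ⟪x, R y⟫_ℂ := by
    intro x y
    rw [← hrR, ← pow_two]
    exact inner_pow_left hr 2 x y
  have hsum : ∀ q, q ≤ m → 0 ≤ ∑ k ∈ Finset.Icc 1 q, e k := fun q hq =>
    Finset.sum_nonneg fun k hk => he k (Finset.mem_Icc.1 hk).1 ((Finset.mem_Icc.1 hk).2.trans hq)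
  have hR1 : ∀ x, ‖R x‖ ≤ ‖x‖ := fun x => by
    rw [← hrR]; exact (hr1 _).trans (hr1 _)
  intro q
  induction q using Nat.strong_induction_on with
  | _ q ih =>
    intro hq hqm w
    match q, hq with
    | 1, _ =>
      have h0 := hsum 1 hqm
      calc ‖(r ^ 1) (B w)‖ ≤ ‖B w‖ := by rw [pow_one]; exact hr1 _
        _ ≤ c * ‖r w‖ := hB w
        _ ≤ _ := by rw [pow_one]; gcongr; linarith
    | 2, _ =>
      have h0 := hsum 2 hqm
      -- Here `R B = B* R` and `‖B*‖ ≤ c`, tested against the vector `R B w` itself.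
      have h1 : ‖R (B w)‖ ≤ c * ‖R w‖ := by
        rcases (norm_nonneg (R (B w))).eq_or_lt with h2 | h2
        · rw [← h2]; positivity
        refine le_of_mul_le_mul_left ?_ h2
        have h3 : ‖R (B w)‖ * ‖R (B w)‖ = ‖⟪B (R (B w)), R w⟫_ℂ‖ := by
          rw [← hsymm, hRs, inner_self_eq_norm_sq_to_K, norm_pow, RCLike.norm_ofReal, abs_norm, pow_two]
        rw [h3]
        have h4 : ‖B (R (B w))‖ ≤ c * ‖R (B w)‖ := (hB _).trans (by gcongr; exact hr1 _)
        calc ‖⟪B (R (B w)), R w⟫_ℂ‖ ≤ ‖B (R (B w))‖ * ‖R w‖ := norm_inner_le_norm _ _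
          _ ≤ c * ‖R (B w)‖ * ‖R w‖ := by gcongr
          _ = _ := by ring
      rw [pow_two, hrR]
      exact h1.trans (by gcongr; linarith)
    | q + 3, _ =>
      have h1 := ih (q + 1) (by omega) (by omega) (by omega) (R w)
      have h2 := hcomm (q + 1) (by omega) hqm w
      have hpow : ∀ x, (r ^ (q + 3)) x = (r ^ (q + 1)) (R x) := by
        intro x
        rw [← hrR, ← pow_two, ← mul_apply_eq_comp, ← pow_add]
      have hpow' : ‖(r ^ (q + 1 + 4)) w‖ ≤ ‖(r ^ (q + 3)) w‖ := by
        rw [show q + 1 + 4 = 2 + (q + 3) by omega, pow_add, mul_apply_eq_comp, pow_two, hrR]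
        exact hR1 _
      have he' : 0 ≤ e (q + 3) := he _ (by omega) hqm
      have hs : c + ∑ k ∈ Finset.Icc 1 (q + 1), e k + e (q + 3) ≤
          c + ∑ k ∈ Finset.Icc 1 (q + 3), e k := by
        rw [Finset.sum_Icc_succ_top (by omega : 1 ≤ q + 2 + 1),
          Finset.sum_Icc_succ_top (by omega : 1 ≤ q + 1 + 1)]
        have : 0 ≤ e (q + 1 + 1) := he _ (by omega) (by omega)
        linarith
      calc ‖(r ^ (q + 3)) (B w)‖
          = ‖(r ^ (q + 1)) (B (R w)) + (r ^ (q + 1)) (R (B w) - B (R w))‖ := by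
            rw [hpow, ← map_add, add_sub_cancel]
        _ ≤ (c + ∑ k ∈ Finset.Icc 1 (q + 1), e k) * ‖(r ^ (q + 1)) (R w)‖
            + e (q + 3) * ‖(r ^ (q + 1 + 4)) w‖ := (norm_add_le _ _).trans (add_le_add h1 h2)
        _ ≤ (c + ∑ k ∈ Finset.Icc 1 (q + 1), e k) * ‖(r ^ (q + 3)) w‖
            + e (q + 3) * ‖(r ^ (q + 3)) w‖ := by
            rw [hpow w]
            rw [hpow w] at hpow'
            gcongr
        _ = (c + ∑ k ∈ Finset.Icc 1 (q + 1), e k + e (q + 3)) * ‖(r ^ (q + 3)) w‖ := by ring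
        _ ≤ _ := by gcongr

/-- A term of the derivative of the `m`-th power of `R`, with more than half of the factors on the
left. -/
theorem norm_inner_pow_mul_pow_le_of_lt (hr : IsSelfAdjoint r) (hrR : r * r = R) {β : ℕ → ℝ}
    (hβ : ∀ q, 1 ≤ q → q ≤ m → ∀ w, ‖(r ^ q) (B w)‖ ≤ β q * ‖(r ^ q) w‖) {i : ℕ}
    (hi : 2 * i < m) (y : ℋ) :
    ‖⟪y, (R ^ (m - i)) (B ((R ^ i) y))⟫_ℂ‖ ≤ β (m - 2 * i) * ‖(r ^ m) y‖ ^ 2 := by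
  have hR : ∀ j, R ^ j = r ^ (2 * j) := fun j => by rw [← hrR, ← pow_two, pow_mul]
  have h1 : ∀ x, (R ^ (m - i)) x = (r ^ m) ((r ^ (m - 2 * i)) x) := by
    intro x
    rw [hR, ← mul_apply_eq_comp, ← pow_add]
    congr 2
    omega
  have h2 : (r ^ (m - 2 * i)) ((R ^ i) y) = (r ^ m) y := by
    rw [hR, ← mul_apply_eq_comp, ← pow_add]
    congr 2
    omega
  rw [h1, ← inner_pow_left hr]
  refine (norm_inner_le_norm _ _).trans ?_
  have h3 := hβ (m - 2 * i) (by omega) (by omega) ((R ^ i) y)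
  rw [h2] at h3
  calc ‖(r ^ m) y‖ * _ ≤ ‖(r ^ m) y‖ * (β (m - 2 * i) * ‖(r ^ m) y‖) := by gcongr
    _ = _ := by ring

theorem norm_inner_pow_mul_pow_symm (hr : IsSelfAdjoint r) (hrR : r * r = R)
    (hsymm : ∀ x y, ⟪R x, B y⟫_ℂ = ⟪B x, R y⟫_ℂ) {i : ℕ} (hi : i < m) (y : ℋ) :
    ‖⟪y, (R ^ (m - i)) (B ((R ^ i) y))⟫_ℂ‖ =
      ‖⟪y, (R ^ (m - (m - 1 - i))) (B ((R ^ (m - 1 - i)) y))⟫_ℂ‖ := by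
  have hRsa : IsSelfAdjoint R := by
    rw [← hrR, ← pow_two]; exact hr.pow 2
  have h1 : R ^ (m - i) = R ^ (m - 1 - i) * R := by
    rw [← pow_succ]; congr 1; omega
  have h2 : R ^ (m - (m - 1 - i)) = R ^ i * R := by
    rw [← pow_succ]; congr 1; omega
  have h3 : ∀ x, R ((R ^ i) x) = (R ^ i) (R x) := fun x => by
    rw [← mul_apply_eq_comp, ← mul_apply_eq_comp, ← pow_succ, ← pow_succ']
  have h4 : ∀ x z, ⟪R x, z⟫_ℂ = ⟪x, R z⟫_ℂ := fun x z => hRsa.isSymmetric x z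
  rw [h1, h2, mul_apply_eq_comp, mul_apply_eq_comp, ← inner_pow_left hRsa,
    ← inner_pow_left hRsa, ← h4, hsymm, ← h4, ← norm_inner_symm]

/-- The derivative `∑_{i<m} R^{m-i} B R^i` of the `m`-th power, as a quadratic form, is bounded by
the power itself: the terms with `2 i < m` are controlled directly, the others are their
complex conjugates. -/
theorem sum_norm_inner_pow_le (hr : IsSelfAdjoint r) (hrR : r * r = R)
    (hsymm : ∀ x y, ⟪R x, B y⟫_ℂ = ⟪B x, R y⟫_ℂ) {β : ℕ → ℝ}
    (hβ0 : ∀ q, 1 ≤ q → q ≤ m → 0 ≤ β q)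
    (hβ : ∀ q, 1 ≤ q → q ≤ m → ∀ w, ‖(r ^ q) (B w)‖ ≤ β q * ‖(r ^ q) w‖) (y : ℋ) :
    ∑ i ∈ Finset.range m, ‖⟪y, (R ^ (m - i)) (B ((R ^ i) y))⟫_ℂ‖ ≤
      2 * (∑ q ∈ Finset.Icc 1 m, β q) * ‖(r ^ m) y‖ ^ 2 := by
  set F := ‖(r ^ m) y‖ ^ 2 with hF
  let t : ℕ → ℝ := fun i => if 2 * i < m then β (m - 2 * i) * F else 0
  have hF0 : 0 ≤ F := sq_nonneg _
  have ht0 : ∀ i, 0 ≤ t i := by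
    intro i
    by_cases h : 2 * i < m
    · simp only [t, if_pos h]
      exact mul_nonneg (hβ0 _ (by omega) (by omega)) hF0
    · simp only [t, if_neg h, le_refl]
  have hterm : ∀ i, 2 * i < m → ‖⟪y, (R ^ (m - i)) (B ((R ^ i) y))⟫_ℂ‖ ≤ t i := by
    intro i hi
    simp only [t, if_pos hi]
    exact norm_inner_pow_mul_pow_le_of_lt hr hrR hβ hi y
  have hle : ∀ i ∈ Finset.range m,
      ‖⟪y, (R ^ (m - i)) (B ((R ^ i) y))⟫_ℂ‖ ≤ t i + t (m - 1 - i) := by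
    intro i hi
    have him := Finset.mem_range.1 hi
    by_cases h : 2 * i < m
    · linarith [hterm i h, ht0 (m - 1 - i)]
    · rw [norm_inner_pow_mul_pow_symm hr hrR hsymm him]
      linarith [hterm (m - 1 - i) (by omega), ht0 i]
  have hsum : ∑ i ∈ Finset.range m, t i ≤ (∑ q ∈ Finset.Icc 1 m, β q) * F := by
    rw [Finset.sum_mul]
    simp only [t]
    rw [← Finset.sum_filter]
    have himg : ∑ i ∈ Finset.range m with 2 * i < m, β (m - 2 * i) * F =
        ∑ q ∈ (Finset.range m |>.filter (2 * · < m)).image (fun i => m - 2 * i), β q * F := by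
      rw [Finset.sum_image]
      intro i hi j hj hij
      simp only [Finset.coe_filter, Set.mem_ofPred_eq, Finset.mem_range] at hi hj hij
      omega
    rw [himg]
    refine Finset.sum_le_sum_of_subset_of_nonneg ?_ ?_
    · intro q hq
      simp only [Finset.mem_image, Finset.mem_filter, Finset.mem_range] at hq
      obtain ⟨i, ⟨_, h⟩, rfl⟩ := hq
      exact Finset.mem_Icc.2 ⟨by omega, by omega⟩
    · intro q hq _
      have := Finset.mem_Icc.1 hq
      exact mul_nonneg (hβ0 q this.1 this.2) hF0
  refine (Finset.sum_le_sum hle).trans ?_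
  rw [Finset.sum_add_distrib, Finset.sum_range_reflect t m]
  linarith

end PowerBounds

/-! ### Switching functions -/

section Switching

theorem abs_le_maxAbs {h : ℝ → ℝ} (hh : Continuous h) {s : ℝ} (hs : s ∈ Set.Icc (0 : ℝ) 1) :
    |h s| ≤ maxAbs h :=
  le_csSup (isCompact_Icc.image hh.abs).bddAbove ⟨s, hs, rfl⟩

theorem maxAbs_nonneg (h : ℝ → ℝ) : 0 ≤ maxAbs h := by
  refine Real.sSup_nonneg ?_
  rintro _ ⟨s, _, rfl⟩
  exact abs_nonneg _

variable {g : ℝ → ℝ}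

theorem deriv_eq_zero_of_notMem (hs : tsupport (deriv g) ⊆ Set.Ioo 0 1) {s : ℝ}
    (h : s ∉ Set.Ioo (0 : ℝ) 1) : deriv g s = 0 :=
  image_eq_zero_of_notMem_tsupport fun h' => h (hs h')

theorem abs_deriv_le_maxAbs (hg : ContDiff ℝ 1 g) (hs : tsupport (deriv g) ⊆ Set.Ioo 0 1)
    (s : ℝ) : |deriv g s| ≤ maxAbs (deriv g) := by
  by_cases h : s ∈ Set.Ioo (0 : ℝ) 1
  · exact abs_le_maxAbs (hg.continuous_deriv le_rfl) (Set.Ioo_subset_Icc_self h)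
  · rw [deriv_eq_zero_of_notMem hs h, abs_zero]
    exact maxAbs_nonneg _

/-- Since `g` vanishes on the negative half-line and is constant on `[1, ∞)`, its maximum over the
unit interval is a global one. -/
theorem abs_le_maxAbs_of_support (hg : ContDiff ℝ 1 g)
    (hs : tsupport (deriv g) ⊆ Set.Ioo 0 1) (h0 : ∀ s < 0, g s = 0) (s : ℝ) :
    |g s| ≤ maxAbs g := by
  rcases lt_or_ge s 0 with h | h
  · rw [h0 s h, abs_zero]
    exact maxAbs_nonneg _
  rcases le_or_gt s 1 with h1 | h1
  · exact abs_le_maxAbs hg.continuous ⟨h, h1⟩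
  · have h2 : ‖g s - g 1‖ ≤ 0 * ‖s - 1‖ :=
      (convex_Ici (1 : ℝ)).norm_image_sub_le_of_norm_deriv_le
        (fun x _ => hg.differentiable one_ne_zero x)
        (fun x hx => by
          rw [deriv_eq_zero_of_notMem hs fun h => absurd h.2 (not_lt.2 hx), norm_zero])
        Set.self_mem_Ici h1.le
    rw [zero_mul] at h2
    rw [sub_eq_zero.1 (norm_le_zero_iff.1 h2)]
    exact abs_le_maxAbs hg.continuous ⟨zero_le_one, le_rfl⟩

/-- The total variation of `g` is at most `max |g'|`, in the form of a primitive of `|g'|` with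
values in `[0, max |g'|]`. -/
theorem exists_primitive_abs_deriv (hg : ContDiff ℝ 1 g)
    (hs : tsupport (deriv g) ⊆ Set.Ioo 0 1) :
    ∃ G : ℝ → ℝ, (∀ s, HasDerivAt G |deriv g s| s) ∧
      ∀ s, G s ∈ Set.Icc 0 (maxAbs (deriv g)) := by
  have hc : Continuous fun s => |deriv g s| := (hg.continuous_deriv le_rfl).abs
  have hM := maxAbs_nonneg (deriv g)
  refine ⟨fun s => ∫ u in (0 : ℝ)..s, |deriv g u|, fun s =>
    intervalIntegral.integral_hasDerivAt_right (hc.intervalIntegrable _ _)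
      (hc.stronglyMeasurableAtFilter _ _) hc.continuousAt, fun s => ?_⟩
  have hle : ∀ s, 0 ≤ s → s ≤ 1 → ∫ u in (0 : ℝ)..s, |deriv g u| ≤ maxAbs (deriv g) := by
    intro s h0 h1
    have h2 := intervalIntegral.norm_integral_le_of_norm_le_const (a := 0) (b := s)
      (f := fun u => |deriv g u|) (C := maxAbs (deriv g))
      (fun u _ => by rw [Real.norm_eq_abs, abs_abs]; exact abs_deriv_le_maxAbs hg hs u)
    rw [sub_zero, abs_of_nonneg h0] at h2
    refine (Real.le_norm_self _).trans (h2.trans ?_)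
    exact mul_le_of_le_one_right hM h1
  have hpos : ∀ s, 0 ≤ s → 0 ≤ ∫ u in (0 : ℝ)..s, |deriv g u| := fun s h0 =>
    intervalIntegral.integral_nonneg h0 fun _ _ => abs_nonneg _
  rcases le_total s 0 with h | h
  · have h1 : ∫ u in (0 : ℝ)..s, |deriv g u| = 0 := by
      refine intervalIntegral.integral_zero_ae (Filter.Eventually.of_forall fun u hu => ?_)
      rw [Set.uIoc_of_ge h] at hu
      rw [deriv_eq_zero_of_notMem hs fun h' => absurd h'.1 (not_lt.2 hu.2), abs_zero]
    change (∫ u in (0 : ℝ)..s, |deriv g u|) ∈ _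
    rw [h1]
    exact ⟨le_rfl, hM⟩
  rcases le_total s 1 with h1 | h1
  · exact ⟨hpos s h, hle s h h1⟩
  · refine ⟨hpos s h, ?_⟩
    have h2 : ∫ u in (1 : ℝ)..s, |deriv g u| = 0 := by
      refine intervalIntegral.integral_zero_ae (Filter.Eventually.of_forall fun u hu => ?_)
      rw [Set.uIoc_of_le h1] at hu
      rw [deriv_eq_zero_of_notMem hs fun h' => absurd h'.2 (not_lt.2 hu.1.le), abs_zero]
    have h3 := intervalIntegral.integral_add_adjacent_intervals (a := 0) (b := 1) (c := s)
      (hc.intervalIntegrable (μ := MeasureTheory.volume) _ _) (hc.intervalIntegrable _ _)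
    change (∫ u in (0 : ℝ)..s, |deriv g u|) ≤ _
    rw [← h3, h2, add_zero]
    exact hle 1 zero_le_one le_rfl

theorem hasDerivAt_phase (hg : Continuous g) (s : ℝ) : HasDerivAt (phase g) (g s) s :=
  intervalIntegral.integral_hasDerivAt_right (hg.intervalIntegrable _ _)
    (hg.stronglyMeasurableAtFilter _ _) hg.continuousAt

/-- Grönwall's inequality in both time directions, for a rate `k` with primitive `G` of bounded
oscillation. -/
theorem le_mul_exp_of_abs_deriv_le {f f' k G : ℝ → ℝ} {V : ℝ}
    (hf : ∀ s, HasDerivAt f (f' s) s) (hf0 : ∀ s, 0 ≤ f s) (hG : ∀ s, HasDerivAt G (k s) s)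
    (hbound : ∀ s, |f' s| ≤ k s * f s) (hV : ∀ s u, G s - G u ≤ V) (s u : ℝ) :
    f s ≤ f u * Real.exp V := by
  have key : ∀ s u, (f s ≤ f u * Real.exp (G s - G u)) ∨ (f s ≤ f u * Real.exp (G u - G s)) := by
    intro s u
    rcases le_total u s with h | h
    · left
      have hd : ∀ τ, HasDerivAt (fun τ => f τ * Real.exp (-G τ))
          (f' τ * Real.exp (-G τ) + f τ * (Real.exp (-G τ) * -k τ)) τ := fun τ =>
        (hf τ).mul (hG τ).neg.exp
      have hanti : Antitone fun τ => f τ * Real.exp (-G τ) := by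
        refine antitone_of_deriv_nonpos (fun τ => (hd τ).differentiableAt) fun τ => ?_
        rw [(hd τ).deriv]
        have h1 := (le_abs_self _).trans (hbound τ)
        have h2 := Real.exp_pos (-G τ)
        nlinarith
      have h1 := hanti h
      have h2 : f s = f s * Real.exp (-G s) * Real.exp (G s) := by
        rw [mul_assoc, ← Real.exp_add, neg_add_cancel, Real.exp_zero, mul_one]
      rw [h2, sub_eq_neg_add, Real.exp_add, ← mul_assoc]
      exact mul_le_mul_of_nonneg_right h1 (Real.exp_pos _).le
    · right
      have hd : ∀ τ, HasDerivAt (fun τ => f τ * Real.exp (G τ))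
          (f' τ * Real.exp (G τ) + f τ * (Real.exp (G τ) * k τ)) τ := fun τ =>
        (hf τ).mul (hG τ).exp
      have hmono : Monotone fun τ => f τ * Real.exp (G τ) := by
        refine monotone_of_deriv_nonneg (fun τ => (hd τ).differentiableAt) fun τ => ?_
        rw [(hd τ).deriv]
        have h1 := (neg_le_abs _).trans (hbound τ)
        have h2 := Real.exp_pos (G τ)
        nlinarith
      have h1 := hmono h
      have h2 : f s = f s * Real.exp (G s) * Real.exp (-G s) := by
        rw [mul_assoc, ← Real.exp_add, add_neg_cancel, Real.exp_zero, mul_one]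
      rw [h2, sub_eq_add_neg, Real.exp_add, ← mul_assoc]
      exact mul_le_mul_of_nonneg_right h1 (Real.exp_pos _).le
  rcases key s u with h | h
  · exact h.trans (mul_le_mul_of_nonneg_left (Real.exp_le_exp.2 (hV s u)) (hf0 u))
  · exact h.trans (mul_le_mul_of_nonneg_left (Real.exp_le_exp.2 (hV u s)) (hf0 u))

end Switching

section QuadraticForm

theorem hasDerivAt_operator_apply {T : ℝ → ℋ →L[ℂ] ℋ} {T' : ℋ →L[ℂ] ℋ} {y : ℝ → ℋ} {y' : ℋ}
    {s : ℝ} (hT : HasDerivAt T T' s) (hy : HasDerivAt y y' s) :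
    HasDerivAt (fun τ => T τ (y τ)) (T' (y s) + T s y') s := by
  have h1 : HasDerivAt (fun τ => ContinuousLinearMap.restrictScalarsL ℂ ℋ ℋ ℝ ℝ (T τ))
      (ContinuousLinearMap.restrictScalarsL ℂ ℋ ℋ ℝ ℝ T') s :=
    (ContinuousLinearMap.restrictScalarsL ℂ ℋ ℋ ℝ ℝ).hasFDerivAt.comp_hasDerivAt s hT
  exact h1.clm_apply hy

variable [CompleteSpace ℋ]

/-- Derivative of `⟨y, R^m y⟩` when the velocity of `y` does not contribute. -/
theorem hasDerivAt_inner_pow {R : ℝ → ℋ →L[ℂ] ℋ} {R' : ℋ →L[ℂ] ℋ} {y : ℝ → ℋ} {y' : ℋ} {s : ℝ}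
    {m : ℕ} (hR : HasDerivAt R R' s) (hy : HasDerivAt y y' s) (hsa : IsSelfAdjoint (R s))
    (h0 : (⟪y', (R s ^ m) (y s)⟫_ℂ).re = 0) :
    HasDerivAt (fun τ => (⟪y τ, (R τ ^ m) (y τ)⟫_ℂ).re)
      (∑ i ∈ Finset.range m,
        ⟪y s, (R s ^ (m - 1 - i)) (R' ((R s ^ i) (y s)))⟫_ℂ).re s := by
  have h1 := hy.inner ℂ (hasDerivAt_operator_apply (hR.fun_pow' m) hy)
  have h2 := Complex.reCLM.hasFDerivAt.comp_hasDerivAt s h1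
  convert! h2 using 1
  have h3 : (⟪y s, (R s ^ m) y'⟫_ℂ).re = 0 := by
    rw [← inner_pow_left hsa, ← h0, ← inner_conj_symm, Complex.conj_re]
  simp only [Complex.reCLM_apply, Complex.add_re, inner_add_right, h0, h3, add_zero,
    sum_apply, inner_sum, Nat.pred_eq_sub_one, mul_apply_eq_comp]

end QuadraticForm

/-! ### The resolvents of the perturbed Hamiltonians -/

section Hamiltonians

variable [CompleteSpace ℋ]

section Unperturbed

variable {H₀ H₁ : ℋ →ₗ.[ℂ] ℋ} {g : ℝ → ℝ} {γ₀ εs a b : ℝ}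

theorem Standing.gap_le (hA : Standing H₀ H₁ g γ₀ εs a b) {x y : ℋ} (h : (x, y) ∈ H₀.graph) :
    (1 + γ₀) * ‖x‖ ≤ ‖y‖ := by
  obtain ⟨u, rfl, rfl⟩ := (LinearPMap.mem_graph_iff _).1 h
  rcases (norm_nonneg (u : ℋ)).eq_or_lt with h0 | h0
  · rw [← h0, mul_zero]
    exact norm_nonneg _
  refine le_of_mul_le_mul_left ?_ h0
  have h1 := (hA.lower u).trans ((Complex.re_le_norm _).trans (norm_inner_le_norm (𝕜 := ℂ) _ _))
  calc ‖(u : ℋ)‖ * ((1 + γ₀) * ‖(u : ℋ)‖) = (1 + γ₀) * ‖(u : ℋ)‖ ^ 2 := by ring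
    _ ≤ _ := h1

theorem Standing.isBoundedInverse (hA : Standing H₀ H₁ g γ₀ εs a b) :
    IsBoundedInverse H₀ (inv H₀) := by
  obtain ⟨B, hB⟩ := exists_isBoundedInverse hA.selfAdjoint₀
    (by linarith [hA.gap_pos] : 0 < 1 + γ₀) fun x y h => hA.gap_le h
  rwa [hB.inv_eq]

theorem Standing.inv_nonneg (hA : Standing H₀ H₁ g γ₀ εs a b) : 0 ≤ inv H₀ := by
  rw [ContinuousLinearMap.nonneg_iff_isPositive, ContinuousLinearMap.isPositive_def']
  refine ⟨isSelfAdjoint_of_isBoundedInverse hA.selfAdjoint₀ hA.isBoundedInverse, fun y => ?_⟩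
  obtain ⟨u, hu, hu'⟩ := (LinearPMap.mem_graph_iff _).1 (hA.isBoundedInverse.mem_graph y)
  have h1 := hA.lower u
  rw [hu', hu] at h1
  have h2 : 0 ≤ (1 + γ₀) * ‖inv H₀ y‖ ^ 2 := by
    have := hA.gap_pos
    positivity
  exact h2.trans h1

/-- The operator `H₁ H₀^{-1/2}` is everywhere defined and bounded. -/
theorem Standing.exists_relative (hA : Standing H₀ H₁ g γ₀ εs a b) :
    ∃ T : ℋ →L[ℂ] ℋ, (∀ y, (invSqrt H₀ y, T y) ∈ H₁.graph) ∧
      ∀ y, ‖T y‖ ≤ a * ‖y‖ + b * ‖invSqrt H₀ y‖ := by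
  have hg : ∀ y, (invSqrt H₀ y, y) ∈ (halfPow H₀ 1).graph := fun y =>
    (mem_graph_halfPow (q := 1) hA.isBoundedInverse hA.inv_nonneg).2 (by rw [pow_one])
  have hd : ∀ y, invSqrt H₀ y ∈ H₁.domain := fun y =>
    hA.domain_le (mem_domain_iff_graph.2 ⟨y, hg y⟩)
  have hb : ∀ y, ‖H₁ ⟨invSqrt H₀ y, hd y⟩‖ ≤ a * ‖y‖ + b * ‖invSqrt H₀ y‖ := by
    intro y
    have h0 := mem_domain_iff_graph.2 ⟨y, hg y⟩
    have := hA.relBound _ h0 (hd y)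
    rwa [apply_eq_of_mem_graph (hg y) h0] at this
  let T₀ : ℋ →ₗ[ℂ] ℋ :=
    H₁.toFun ∘ₗ (LinearMap.codRestrict H₁.domain (invSqrt H₀ : ℋ →ₗ[ℂ] ℋ) hd)
  have hT₀ : ∀ y, T₀ y = H₁ ⟨invSqrt H₀ y, hd y⟩ := fun _ => rfl
  refine ⟨T₀.mkContinuous (a + b * ‖invSqrt H₀‖) fun y => ?_, fun y => ?_, fun y => ?_⟩
  · rw [hT₀]
    refine (hb y).trans ?_
    have h1 := (invSqrt H₀).le_opNorm y
    have h2 := hA.b_nonneg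
    calc a * ‖y‖ + b * ‖invSqrt H₀ y‖ ≤ a * ‖y‖ + b * (‖invSqrt H₀‖ * ‖y‖) := by gcongr
      _ = _ := by ring
  · exact H₁.mem_graph ⟨invSqrt H₀ y, hd y⟩
  · exact hb y

theorem norm_relative_le {T : ℋ →L[ℂ] ℋ}
    (hT : ∀ y, (invSqrt H₀ y, T y) ∈ H₁.graph) (y : ℋ) :
    ‖T y‖ ≤ opNorm (comp H₁ (halfPow H₀ (-1))) * ‖y‖ := by
  have hgr : ∀ u v, (u, v) ∈ (comp H₁ (halfPow H₀ (-1))).graph → v = T u := by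
    intro u v huv
    obtain ⟨w, hw, hv⟩ := mem_graph_comp.1 huv
    obtain rfl := (mem_graph_halfPow_neg (q := 1)).1 hw
    rw [pow_one] at hv
    exact graph_unique hv (hT u)
  refine norm_le_opNorm (norm_nonneg T) (fun u v huv => ?_) (mem_graph_comp.2 ⟨_,
    (mem_graph_halfPow_neg (q := 1)).2 rfl, ?_⟩)
  · rw [hgr u v huv]
    exact T.le_opNorm u
  · rw [pow_one]
    exact hT y

theorem Standing.norm_relative_inv_le (hA : Standing H₀ H₁ g γ₀ εs a b) {B : ℋ →L[ℂ] ℋ}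
    (hB : ∀ y, (inv H₀ y, B y) ∈ H₁.graph) : ‖B‖ ≤ opNorm (comp H₁ (halfPow H₀ (-2))) := by
  have hsq : ∀ y, (invSqrt H₀ ^ 2) y = inv H₀ y := fun y => by
    rw [pow_two, invSqrt_mul_self hA.isBoundedInverse hA.inv_nonneg]
  refine ContinuousLinearMap.opNorm_le_bound _ (opNorm_nonneg _) fun y => ?_
  refine norm_le_opNorm (norm_nonneg B) (fun u v huv => ?_) (mem_graph_comp.2 ⟨_,
    (mem_graph_halfPow_neg (q := 2)).2 rfl, ?_⟩)
  · obtain ⟨w, hw, hv⟩ := mem_graph_comp.1 huv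
    obtain rfl := (mem_graph_halfPow_neg (q := 2)).1 hw
    rw [hsq] at hv
    rw [graph_unique hv (hB u)]
    exact B.le_opNorm u
  · rw [hsq]
    exact hB y

end Unperturbed

/-- The bounded operators attached to the Hamiltonian `H = H₀ + l H₁`, `l = ε g(s)`:
`R s = H⁻¹` and `B s = H₁ H⁻¹`, with the properties of them and of `H^{-1/2}` that control the
derivative of `R s ^ m` in `s`. -/
structure ResolventFamily (H₀ H₁ : ℋ →ₗ.[ℂ] ℋ) (g : ℝ → ℝ) (ε c : ℝ)
    (R B : ℝ → ℋ →L[ℂ] ℋ) : Prop where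
  isBoundedInverse : ∀ s, IsBoundedInverse (H₀ + ((ε * g s : ℝ) : ℂ) • H₁) (R s)
  nonneg : ∀ s, 0 ≤ R s
  mem_graph : ∀ s y, (R s y, B s y) ∈ H₁.graph
  symm : ∀ s x y, ⟪R s x, B s y⟫_ℂ = ⟪B s x, R s y⟫_ℂ
  contraction : ∀ s x, ‖invSqrt (H₀ + ((ε * g s : ℝ) : ℂ) • H₁) x‖ ≤ ‖x‖
  relBound : ∀ s w, ‖B s w‖ ≤ c * ‖invSqrt (H₀ + ((ε * g s : ℝ) : ℂ) • H₁) w‖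
  hasDerivAt : ∀ s, HasDerivAt R (((ε * deriv g s : ℝ) : ℂ) • -(R s * B s)) s

variable {H₀ H₁ : ℋ →ₗ.[ℂ] ℋ} {g : ℝ → ℝ} {γ₀ εs a b : ℝ}

/-- The threshold on the intensity makes the perturbed Hamiltonians invertible, with inverses of
norm at most one. -/
theorem Standing.exists_resolventFamily (hA : Standing H₀ H₁ g γ₀ εs a b) {ε : ℝ}
    (hε : ε ∈ Set.Ioc 0 εs) :
    ∃ R B : ℝ → ℋ →L[ℂ] ℋ, ResolventFamily H₀ H₁ g ε
      (a * (1 + ε * maxAbs g * opNorm (comp H₁ (halfPow H₀ (-1)))) + b) R B := by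
  obtain ⟨T, hT, hTb⟩ := hA.exists_relative
  set r₀ := invSqrt H₀ with hr₀
  set N := opNorm (comp H₁ (halfPow H₀ (-1))) with hN
  have hN0 : 0 ≤ N := opNorm_nonneg _
  have hM0 := maxAbs_nonneg g
  have hR := hA.isBoundedInverse
  have hr₀R : r₀ * r₀ = inv H₀ := invSqrt_mul_self hR hA.inv_nonneg
  have hr₀sa : IsSelfAdjoint r₀ := isSelfAdjoint_invSqrt H₀
  let B₀ : ℋ →L[ℂ] ℋ := T * r₀
  have hB : ∀ y, (inv H₀ y, B₀ y) ∈ H₁.graph := fun y => by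
    rw [← hr₀R]
    exact hT (r₀ y)
  have hBN : ∀ v, ‖B₀ v‖ ≤ N * ‖r₀ v‖ := fun v => norm_relative_le hT _
  have hrel : ∀ v, ‖B₀ v‖ ≤ a * ‖r₀ v‖ + b * ‖inv H₀ v‖ := fun v => by
    rw [← hr₀R]
    exact hTb (r₀ v)
  have hgs := abs_le_maxAbs_of_support hA.contDiff hA.support hA.zero_of_neg
  set δ := εs * maxAbs g * opNorm (comp H₁ (halfPow H₀ (-2))) with hδ
  have hδ0 : 0 ≤ δ := mul_nonneg (mul_nonneg hA.threshold_pos.le hM0) (opNorm_nonneg _)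
  have hγ := hA.gap_pos
  have hδγ : (3 * γ₀ + 1) * δ < γ₀ := by
    have h1 := hA.threshold
    have h2 : (3 * γ₀ + 1) / γ₀ * εs * maxAbs g * opNorm (comp H₁ (halfPow H₀ (-2))) =
        (3 * γ₀ + 1) * δ / γ₀ := by
      rw [hδ]; ring
    rwa [h2, div_lt_one hγ] at h1
  have hδ1 : δ < 1 := by nlinarith
  have hl : ∀ s, |ε * g s| ≤ ε * maxAbs g := fun s => by
    rw [abs_mul, abs_of_pos hε.1]
    exact mul_le_mul_of_nonneg_left (hgs s) hε.1.le
  have hsmall : ∀ s, ‖((ε * g s : ℝ) : ℂ) • B₀‖ ≤ δ := fun s => by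
    rw [norm_smul, Complex.norm_real, Real.norm_eq_abs]
    calc |ε * g s| * ‖B₀‖ ≤ (εs * maxAbs g) * opNorm (comp H₁ (halfPow H₀ (-2))) := by
          gcongr
          · exact mul_nonneg hA.threshold_pos.le hM0
          · exact (hl s).trans (mul_le_mul_of_nonneg_right hε.2 hM0)
          · exact hA.norm_relative_inv_le hB
      _ = δ := hδ.symm
  have hsmall1 : ∀ s, ‖((ε * g s : ℝ) : ℂ) • B₀‖ < 1 := fun s => (hsmall s).trans_lt hδ1
  let R : ℝ → ℋ →L[ℂ] ℋ := fun s => neumann (inv H₀) B₀ (ε * g s)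
  have hinv : ∀ s, IsBoundedInverse (H₀ + ((ε * g s : ℝ) : ℂ) • H₁) (R s) := fun s =>
    isBoundedInverse_neumann hR hB (hsmall1 s)
  have hpos : ∀ s, 0 ≤ R s := fun s =>
    neumann_nonneg hR hB hA.selfAdjoint₀ hA.selfAdjoint₁ hA.inv_nonneg (hsmall1 s)
  have hle : ∀ s y, ‖R s y‖ ≤ ‖y‖ := fun s =>
    norm_neumann_le (c := 1 + γ₀) (hsmall s) hδ1 (fun y => hA.gap_le (hR.mem_graph y))
      (by nlinarith)
  have hcontr : ∀ s x, ‖invSqrt (H₀ + ((ε * g s : ℝ) : ℂ) • H₁) x‖ ≤ ‖x‖ := by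
    intro s x
    refine abs_le_of_sq_le_sq' ?_ (norm_nonneg x) |>.2
    have h1 := norm_sq_pow_apply (isSelfAdjoint_invSqrt (H₀ + ((ε * g s : ℝ) : ℂ) • H₁)) 1 x
    rw [pow_one, pow_one, invSqrt_mul_self (hinv s) (hpos s)] at h1
    rw [h1]
    refine (Complex.re_le_norm _).trans ((norm_inner_le_norm _ _).trans ?_)
    rw [pow_two]
    exact mul_le_mul_of_nonneg_left (hle s x) (norm_nonneg x)
  refine ⟨R, fun s => neumann B₀ B₀ (ε * g s), hinv, hpos, fun s => mem_graph_neumann hB,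
    fun s => inner_neumann_comm hB hA.selfAdjoint₁, hcontr, fun s w => ?_, fun s => ?_⟩
  · refine (norm_neumann_le_rel hA.a_nonneg hA.b_nonneg hN0 hr₀sa hr₀R
      (isSelfAdjoint_invSqrt _) (invSqrt_mul_self (hinv s) (hpos s)) (hcontr s) (hsmall1 s)
      hrel hBN w).trans ?_
    have := hl s
    have := hA.a_nonneg
    gcongr
  · have h1 : HasDerivAt (fun s => ε * g s) (ε * deriv g s) s :=
      ((hA.contDiff.differentiable one_ne_zero) s).hasDerivAt.const_mul ε
    have h2 := (hasDerivAt_neumann (R := inv H₀) (hsmall1 s)).scomp s h1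
    convert! h2 using 1

variable {K : ℋ →ₗ.[ℂ] ℋ} {ε c : ℝ} {R B : ℝ → ℋ →L[ℂ] ℋ}

/-- On the range of `R ^ 2`, the operator `R [H₁, H] = R [H₁, H₀]` is given by the commutator of
`R` and `B`. -/
theorem ResolventFamily.apply_commutator (hF : ResolventFamily H₀ H₁ g ε c R B)
    (hK : IsCommutator H₀ H₁ K) (s : ℝ) (w : ℋ) {z : ℋ}
    (hz : (R s (R s w), z) ∈ K.graph) : R s z = R s (B s w) - B s (R s w) := by
  set l : ℂ := ((ε * g s : ℝ) : ℂ) with hl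
  have hlc : (starRingEnd ℂ) l = l := Complex.conj_ofReal _
  have hsa : ∀ x y, ⟪R s x, y⟫_ℂ = ⟪x, R s y⟫_ℂ := fun x y =>
    (hF.nonneg s).isSelfAdjoint.isSymmetric x y
  have hgr : ∀ x, (R s x, x - l • B s x) ∈ H₀.graph := by
    intro x
    obtain ⟨u, v, hu, hv, hx⟩ := mem_graph_perturbation.1 ((hF.isBoundedInverse s).mem_graph x)
    rw [graph_unique hv (hF.mem_graph s x)] at hx
    rwa [sub_eq_of_eq_add hx]
  refine ext_inner_left ℂ fun v => ?_
  have h0 := hgr v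
  have h1 := hgr (R s w)
  have h2 := hF.mem_graph s v
  have h3 := hF.mem_graph s (R s w)
  have key := hK.2 (R s v) (R s (R s w)) (mem_domain_iff_graph.2 ⟨_, h0⟩)
    (mem_domain_iff_graph.2 ⟨_, h1⟩) (mem_domain_iff_graph.2 ⟨_, h2⟩)
    (mem_domain_iff_graph.2 ⟨_, h3⟩) (mem_domain_iff_graph.2 ⟨_, hz⟩)
  rw [apply_eq_of_mem_graph hz, apply_eq_of_mem_graph h0, apply_eq_of_mem_graph h1,
    apply_eq_of_mem_graph h2, apply_eq_of_mem_graph h3] at key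
  rw [← hsa, key, inner_sub_right, inner_sub_right, inner_sub_left, inner_smul_left,
    inner_smul_right, hlc, ← hF.symm, hsa]
  ring

end Hamiltonians

/-! ### Growth of the powers along the switching -/

section Growth

theorem perturbed_one (H₀ H₁ : ℋ →ₗ.[ℂ] ℋ) (g : ℝ → ℝ) (ε s : ℝ) :
    perturbed H₀ H₁ g ε 1 s = H₀ + ((ε * g s : ℝ) : ℂ) • H₁ := by
  rw [perturbed, one_mul]

variable [CompleteSpace ℋ] {H₀ H₁ K : ℋ →ₗ.[ℂ] ℋ} {g : ℝ → ℝ} {γ₀ εs a b : ℝ} {E : ℤ → ℝ}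

/-- The commutator condition with index `-(q + 2)`, rewritten for bounded operators. -/
theorem ResolventFamily.norm_commutator_le {ε c : ℝ} {R B : ℝ → ℋ →L[ℂ] ℋ}
    (hF : ResolventFamily H₀ H₁ g ε c R B) (hε : ε ∈ Set.Ioc 0 εs) {q : ℕ} {e : ℝ}
    (hK : CommutatorBound H₀ H₁ K g εs (-((q + 2 : ℕ) : ℤ)) e)
    (hdom : H₀.domain ≤ K.domain) (s : ℝ) (w : ℋ) :
    ‖(invSqrt (H₀ + ((ε * g s : ℝ) : ℂ) • H₁) ^ q) (R s (B s w) - B s (R s w))‖ ≤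
      e * ‖(invSqrt (H₀ + ((ε * g s : ℝ) : ℂ) • H₁) ^ (q + 4)) w‖ := by
  obtain ⟨-, hn⟩ := hK.2 ε hε 1 one_pos s
  rw [perturbed_one, show -(-((q + 2 : ℕ) : ℤ) + 2) = (q : ℤ) by push_cast; ring] at hn
  set H := H₀ + ((ε * g s : ℝ) : ℂ) • H₁
  have hinv := hF.isBoundedInverse s
  have hpos := hF.nonneg s
  have hsq : invSqrt H ^ 2 = R s := by rw [pow_two, invSqrt_mul_self hinv hpos]
  obtain ⟨u, -, hu, -, -⟩ := mem_graph_perturbation.1 (hinv.mem_graph (R s w))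
  obtain ⟨z, hz⟩ := mem_domain_iff_graph.1 (hdom (mem_domain_iff_graph.2 ⟨u, hu⟩))
  have h1 := hn.graph_le (mem_graph_comp.2 ⟨z, mem_graph_comp.2 ⟨_,
    (mem_graph_halfPow hinv hpos).2 rfl, hz⟩, mem_graph_halfPow_neg.2 rfl⟩)
  rw [pow_add, mul_apply_eq_comp, hsq, hF.apply_commutator hK.1 s w hz] at h1
  have h4 : invSqrt H ^ (q + 4) = invSqrt H ^ q * (R s * R s) := by
    rw [← hsq, ← pow_add, ← pow_add]
  rw [h4]
  exact h1

theorem ResolventFamily.inner_pow_eq {ε c : ℝ} {R B : ℝ → ℋ →L[ℂ] ℋ}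
    (hF : ResolventFamily H₀ H₁ g ε c R B) (m : ℕ) (s : ℝ) (x : ℋ) :
    (⟪x, (R s ^ m) x⟫_ℂ).re = ‖(invSqrt (H₀ + ((ε * g s : ℝ) : ℂ) • H₁) ^ m) x‖ ^ 2 := by
  rw [norm_sq_pow_apply (isSelfAdjoint_invSqrt _),
    invSqrt_mul_self (hF.isBoundedInverse s) (hF.nonneg s)]

/-- The exponential rate at which `‖H^{-m/2} y‖` may grow along the switching, for a relative
bound `c` of `H₁` and commutator constants `e`. -/
def growthRate (e : ℕ → ℝ) (c : ℝ) (m : ℕ) : ℝ :=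
  ∑ q ∈ Finset.Icc 1 m, (c + ∑ k ∈ Finset.Icc 1 q, e k)

/-- If the velocity of `y` does not contribute to the derivative of `‖H^{-m/2} y‖²`, where
`H = H₀ + ε g(s) H₁`, then this quantity varies only through `g`, in a controlled way. -/
theorem ResolventFamily.norm_pow_le (hA : Standing H₀ H₁ g γ₀ εs a b) {ε c : ℝ}
    {R B : ℝ → ℋ →L[ℂ] ℋ} (hF : ResolventFamily H₀ H₁ g ε c R B) (hε : ε ∈ Set.Ioc 0 εs)
    (hc : 0 ≤ c) {m : ℕ} (hE : ∀ k : ℕ, 1 ≤ k → k ≤ m → 0 ≤ E (-(k : ℤ)))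
    (hK : ∀ k : ℕ, 1 ≤ k → k ≤ m → CommutatorBound H₀ H₁ K g εs (-(k : ℤ)) (E (-(k : ℤ))))
    {y y' : ℝ → ℋ} (hy : ∀ s, HasDerivAt y (y' s) s)
    (h0 : ∀ s, (⟪y' s, (R s ^ m) (y s)⟫_ℂ).re = 0) (s u : ℝ) :
    ‖(invSqrt (H₀ + ((ε * g s : ℝ) : ℂ) • H₁) ^ m) (y s)‖ ≤
      Real.exp (ε * maxAbs (deriv g) * growthRate (fun k => E (-(k : ℤ))) c m) *
        ‖(invSqrt (H₀ + ((ε * g u : ℝ) : ℂ) • H₁) ^ m) (y u)‖ := by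
  set e : ℕ → ℝ := fun k => E (-(k : ℤ)) with he
  set S := growthRate e c m with hS
  obtain ⟨G, hG, hG01⟩ := exists_primitive_abs_deriv hA.contDiff hA.support
  let f : ℝ → ℝ := fun s => (⟪y s, (R s ^ m) (y s)⟫_ℂ).re
  have hf_eq : ∀ s, f s = ‖(invSqrt (H₀ + ((ε * g s : ℝ) : ℂ) • H₁) ^ m) (y s)‖ ^ 2 := fun s =>
    hF.inner_pow_eq m s (y s)
  have hsums : ∀ q, q ≤ m → 0 ≤ ∑ k ∈ Finset.Icc 1 q, e k := fun q hq =>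
    Finset.sum_nonneg fun k hk => hE k (Finset.mem_Icc.1 hk).1 ((Finset.mem_Icc.1 hk).2.trans hq)
  have hS0 : 0 ≤ S := Finset.sum_nonneg fun q hq =>
    add_nonneg hc (hsums q (Finset.mem_Icc.1 hq).2)
  have hdom : 1 ≤ m → H₀.domain ≤ K.domain := by
    intro hm x hx
    refine (hK 1 le_rfl hm).1.1 ?_
    obtain ⟨v, hv⟩ := mem_domain_iff_graph.1 hx
    obtain rfl := (hA.isBoundedInverse _ _).1 hv
    refine (mem_domain_halfPow (q := 1) hA.isBoundedInverse hA.inv_nonneg).2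
      ⟨invSqrt H₀ v, ?_⟩
    rw [pow_one, ← mul_apply_eq_comp, invSqrt_mul_self hA.isBoundedInverse hA.inv_nonneg]
  have hd : ∀ s, HasDerivAt f _ s := fun s =>
    hasDerivAt_inner_pow (hF.hasDerivAt s) (hy s) (hF.nonneg s).isSelfAdjoint (h0 s)
  have hbound : ∀ s, |(∑ i ∈ Finset.range m, ⟪y s, (R s ^ (m - 1 - i))
      ((((ε * deriv g s : ℝ) : ℂ) • -(R s * B s)) ((R s ^ i) (y s)))⟫_ℂ).re| ≤
      (2 * (ε * S) * |deriv g s|) * f s := by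
    intro s
    set r := invSqrt (H₀ + ((ε * g s : ℝ) : ℂ) • H₁)
    have hr : IsSelfAdjoint r := isSelfAdjoint_invSqrt _
    have hrR : r * r = R s := invSqrt_mul_self (hF.isBoundedInverse s) (hF.nonneg s)
    have hpow := norm_pow_mul_le (e := e) (m := m) hr hrR (hF.contraction s) hc (hF.relBound s)
      (hF.symm s) hE fun q _ hq w =>
        hF.norm_commutator_le hε (hK (q + 2) (by omega) hq) (hdom (by omega)) s w
    have hsum := sum_norm_inner_pow_le hr hrR (hF.symm s)
      (fun q _ hqm => add_nonneg hc (hsums q hqm)) hpow (y s)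
    refine (Complex.abs_re_le_norm _).trans ((norm_sum_le _ _).trans ?_)
    have hterm : ∀ i ∈ Finset.range m, ‖⟪y s, (R s ^ (m - 1 - i))
        ((((ε * deriv g s : ℝ) : ℂ) • -(R s * B s)) ((R s ^ i) (y s)))⟫_ℂ‖ =
        ε * |deriv g s| * ‖⟪y s, (R s ^ (m - i)) (B s ((R s ^ i) (y s)))⟫_ℂ‖ := by
      intro i hi
      have him := Finset.mem_range.1 hi
      have h1 : R s ^ (m - i) = R s ^ (m - 1 - i) * R s := by
        rw [← pow_succ]; congr 1; omega
      rw [h1, smul_apply, neg_apply, map_smul, map_neg, inner_smul_right, inner_neg_right,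
        norm_mul, norm_neg, Complex.norm_real, Real.norm_eq_abs, abs_mul, abs_of_pos hε.1]
      rfl
    rw [Finset.sum_congr rfl hterm, ← Finset.mul_sum, hf_eq]
    have h2 : 0 ≤ ε * |deriv g s| := mul_nonneg hε.1.le (abs_nonneg _)
    refine (mul_le_mul_of_nonneg_left hsum h2).trans (le_of_eq ?_)
    rw [hS, growthRate]
    ring
  have hεS : 0 ≤ 2 * (ε * S) := by have := hε.1; positivity
  have hgron := le_mul_exp_of_abs_deriv_le (V := 2 * (ε * S) * maxAbs (deriv g)) hd
    (fun s => by rw [hf_eq]; exact sq_nonneg _) (fun s => (hG s).const_mul (2 * (ε * S)))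
    hbound (fun s u => by
      rw [← mul_sub]
      exact mul_le_mul_of_nonneg_left (by linarith [(hG01 s).2, (hG01 u).1]) hεS) s u
  rw [hf_eq, hf_eq] at hgron
  refine abs_le_of_sq_le_sq' ?_ (by positivity) |>.2
  refine hgron.trans (le_of_eq ?_)
  rw [mul_pow, ← Real.exp_nat_mul, mul_comm]
  congr 2
  push_cast
  ring

/-- The powers of the perturbed and of the unperturbed resolvent are comparable, uniformly in the
time: apply the growth estimate to a constant vector, the perturbation being switched off at
negative times. -/
theorem ResolventFamily.norm_pow_le_unperturbed (hA : Standing H₀ H₁ g γ₀ εs a b) {ε c : ℝ}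
    {R B : ℝ → ℋ →L[ℂ] ℋ} (hF : ResolventFamily H₀ H₁ g ε c R B) (hε : ε ∈ Set.Ioc 0 εs)
    (hc : 0 ≤ c) {m : ℕ} (hE : ∀ k : ℕ, 1 ≤ k → k ≤ m → 0 ≤ E (-(k : ℤ)))
    (hK : ∀ k : ℕ, 1 ≤ k → k ≤ m → CommutatorBound H₀ H₁ K g εs (-(k : ℤ)) (E (-(k : ℤ))))
    (s : ℝ) (x : ℋ) :
    ‖(invSqrt (H₀ + ((ε * g s : ℝ) : ℂ) • H₁) ^ m) x‖ ≤
        Real.exp (ε * maxAbs (deriv g) * growthRate (fun k => E (-(k : ℤ))) c m) *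
          ‖(invSqrt H₀ ^ m) x‖ ∧
      ‖(invSqrt H₀ ^ m) x‖ ≤
        Real.exp (ε * maxAbs (deriv g) * growthRate (fun k => E (-(k : ℤ))) c m) *
          ‖(invSqrt (H₀ + ((ε * g s : ℝ) : ℂ) • H₁) ^ m) x‖ := by
  have h1 : invSqrt (H₀ + ((ε * g (-1) : ℝ) : ℂ) • H₁) = invSqrt H₀ := by
    have h2 : inv (H₀ + ((ε * g (-1) : ℝ) : ℂ) • H₁) = inv H₀ := by
      refine IsBoundedInverse.inv_eq fun x y => ?_
      rw [← hA.isBoundedInverse, mem_graph_perturbation, hA.zero_of_neg (-1) (by norm_num)]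
      simp only [mul_zero, Complex.ofReal_zero, zero_smul, add_zero]
      constructor
      · rintro ⟨u, v, hu, -, rfl⟩
        exact hu
      · intro h
        obtain ⟨T, hT, -⟩ := hA.exists_relative
        obtain rfl := (hA.isBoundedInverse _ _).1 h
        refine ⟨y, T (invSqrt H₀ y), h, ?_, rfl⟩
        rw [← invSqrt_mul_self hA.isBoundedInverse hA.inv_nonneg]
        exact hT _
    rw [invSqrt, invSqrt, h2]
  have key := hF.norm_pow_le hA hε hc hE hK (y := fun _ => x) (y' := fun _ => 0)
    (fun s => hasDerivAt_const s x) (fun s => by rw [inner_zero_left, Complex.zero_re])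
  rw [← h1]
  exact ⟨key s (-1), key (-1) s⟩

end Growth

/-! ### Unitary groups generated by bounded self-adjoint operators -/

section BoundedGroup

variable [CompleteSpace ℋ]

/-- The unitary group `t ↦ exp (i t C)` of a bounded operator `C`. -/
def boundedGroup (C : ℋ →L[ℂ] ℋ) (t : ℝ) : ℋ →L[ℂ] ℋ :=
  NormedSpace.exp (t • (Complex.I • C))

theorem boundedGroup_zero (C : ℋ →L[ℂ] ℋ) : boundedGroup C 0 = 1 := by
  rw [boundedGroup, zero_smul, NormedSpace.exp_zero]

theorem boundedGroup_add (C : ℋ →L[ℂ] ℋ) (s t : ℝ) :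
    boundedGroup C (s + t) = boundedGroup C s * boundedGroup C t := by
  let _ : NormedAlgebra ℚ (ℋ →L[ℂ] ℋ) := NormedAlgebra.restrictScalars ℚ ℂ (ℋ →L[ℂ] ℋ)
  rw [boundedGroup, add_smul, NormedSpace.exp_add_of_commute]
  · rfl
  · exact (Commute.refl _).smul_left _ |>.smul_right _

theorem boundedGroup_add_operator {C D : ℋ →L[ℂ] ℋ} (h : Commute C D) (t : ℝ) :
    boundedGroup (C + D) t = boundedGroup C t * boundedGroup D t := by
  let _ : NormedAlgebra ℚ (ℋ →L[ℂ] ℋ) := NormedAlgebra.restrictScalars ℚ ℂ (ℋ →L[ℂ] ℋ)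
  rw [boundedGroup, smul_add, smul_add, NormedSpace.exp_add_of_commute]
  · rfl
  · exact (((h.smul_left Complex.I).smul_right Complex.I).smul_left t).smul_right t

theorem inner_boundedGroup_left {C : ℋ →L[ℂ] ℋ} (hC : IsSelfAdjoint C) (t : ℝ) (x y : ℋ) :
    ⟪boundedGroup C t x, y⟫_ℂ = ⟪x, boundedGroup C (-t) y⟫_ℂ := by
  have h1 : star (boundedGroup C t) = boundedGroup C (-t) := by
    have h2 : star (t • (Complex.I • C)) = (-t) • (Complex.I • C) := by
      rw [star_smul, star_smul, hC.star_eq, neg_smul, ← smul_neg, ← neg_smul]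
      simp
    rw [boundedGroup, NormedSpace.star_exp, h2]
    rfl
  rw [← h1]
  exact (ContinuousLinearMap.adjoint_inner_right (boundedGroup C t) x y).symm

theorem boundedGroup_neg_apply (C : ℋ →L[ℂ] ℋ) (t : ℝ) (x : ℋ) :
    boundedGroup C (-t) (boundedGroup C t x) = x := by
  rw [← mul_apply_eq_comp, ← boundedGroup_add, neg_add_cancel, boundedGroup_zero,
    one_apply_eq_self]

theorem norm_boundedGroup_apply {C : ℋ →L[ℂ] ℋ} (hC : IsSelfAdjoint C) (t : ℝ) (x : ℋ) :
    ‖boundedGroup C t x‖ = ‖x‖ := by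
  rw [@norm_eq_sqrt_re_inner ℂ, @norm_eq_sqrt_re_inner ℂ _ _ _ _ x, inner_boundedGroup_left hC,
    boundedGroup_neg_apply]

theorem hasDerivAt_boundedGroup_apply (C : ℋ →L[ℂ] ℋ) (x : ℋ) (t : ℝ) :
    HasDerivAt (fun t => boundedGroup C t x) (boundedGroup C t (Complex.I • C x)) t := by
  have h1 := hasDerivAt_exp_smul_const (𝕂 := ℝ) (Complex.I • C) t
  have h2 := hasDerivAt_operator_apply h1 (hasDerivAt_const t x)
  rw [map_zero, add_zero] at h2
  exact h2

theorem norm_boundedGroup_sub_le {C : ℋ →L[ℂ] ℋ} (hC : IsSelfAdjoint C) (t : ℝ) (x : ℋ) :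
    ‖boundedGroup C t x - x‖ ≤ |t| * ‖C x‖ := by
  have h1 := Convex.norm_image_sub_le_of_norm_hasDerivWithin_le (s := Set.univ) (x := 0) (y := t)
    (C := ‖C x‖) (fun s _ => (hasDerivAt_boundedGroup_apply C x s).hasDerivWithinAt)
    (fun s _ => by rw [norm_boundedGroup_apply hC, norm_smul, Complex.norm_I, one_mul])
    convex_univ trivial trivial
  rwa [boundedGroup_zero, one_apply_eq_self, sub_zero, Real.norm_eq_abs, mul_comm] at h1

theorem norm_boundedGroup_sub_boundedGroup_le {C D : ℋ →L[ℂ] ℋ} (hC : IsSelfAdjoint C)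
    (hD : IsSelfAdjoint D) (hCD : Commute C D) (t : ℝ) (x : ℋ) :
    ‖boundedGroup C t x - boundedGroup D t x‖ ≤ |t| * ‖C x - D x‖ := by
  have h1 : boundedGroup C t = boundedGroup D t * boundedGroup (C - D) t := by
    rw [← boundedGroup_add_operator (hCD.symm.sub_right (Commute.refl D)), add_sub_cancel]
  rw [h1, mul_apply_eq_comp, ← map_sub, norm_boundedGroup_apply hD]
  exact norm_boundedGroup_sub_le (hC.sub hD) t x

/-- First order expansion of the group, uniform in `C` near a vector with approximate image `w`. -/
theorem norm_boundedGroup_sub_sub_le {C : ℋ →L[ℂ] ℋ} (hC : IsSelfAdjoint C) (t : ℝ) (x w : ℋ) :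
    ‖boundedGroup C t x - x - t • (Complex.I • w)‖ ≤ (‖C x - w‖ + |t| * ‖C w‖) * |t| := by
  have hd : ∀ s, HasDerivAt (fun s : ℝ => boundedGroup C s x - s • (Complex.I • w))
      (boundedGroup C s (Complex.I • C x) - (1 : ℝ) • (Complex.I • w)) s := fun s =>
    (hasDerivAt_boundedGroup_apply C x s).sub ((hasDerivAt_id s).smul_const _)
  have h1 := Convex.norm_image_sub_le_of_norm_hasDerivWithin_le (s := Metric.closedBall 0 |t|)
    (x := 0) (y := t) (C := ‖C x - w‖ + |t| * ‖C w‖)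
    (fun s _ => (hd s).hasDerivWithinAt)
    (fun s hs => by
      have hst : |s| ≤ |t| := by simpa using hs
      have h2 : boundedGroup C s (Complex.I • C x) - (1 : ℝ) • (Complex.I • w) =
          Complex.I • (boundedGroup C s (C x - w) + (boundedGroup C s w - w)) := by
        rw [one_smul, map_smul, map_sub, ← smul_sub]
        congr 1
        abel
      rw [h2, norm_smul, Complex.norm_I, one_mul]
      refine (norm_add_le _ _).trans ?_
      rw [norm_boundedGroup_apply hC]
      have := norm_boundedGroup_sub_le hC s w
      gcongr
      exact this.trans (by gcongr))
    (convex_closedBall 0 |t|) (by simp) (by simp)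
  rw [boundedGroup_zero, one_apply_eq_self, sub_zero, Real.norm_eq_abs, zero_smul, sub_zero] at h1
  rwa [sub_right_comm]

end BoundedGroup

/-! ### Unitary groups generated by unbounded self-adjoint operators -/

section Stone

variable {A : ℋ →ₗ.[ℂ] ℋ}

/-- A sequence of contractions that converges strongly on a dense set converges strongly. -/
theorem cauchySeq_apply_of_dense {T : ℕ → ℋ →L[ℂ] ℋ} (hT : ∀ n x, ‖T n x‖ ≤ ‖x‖) {D : Set ℋ}
    (hD : Dense D) (hc : ∀ x ∈ D, CauchySeq fun n => T n x) (x : ℋ) :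
    CauchySeq fun n => T n x := by
  rw [Metric.cauchySeq_iff]
  intro ε hε
  obtain ⟨d, hdD, hd⟩ := hD.exists_dist_lt x (by positivity : 0 < ε / 3)
  obtain ⟨N, hN⟩ := Metric.cauchySeq_iff.1 (hc d hdD) (ε / 3) (by positivity)
  refine ⟨N, fun m hm n hn => ?_⟩
  have h1 : ∀ k, dist (T k x) (T k d) < ε / 3 := fun k => by
    rw [dist_eq_norm, ← map_sub]
    refine (hT k _).trans_lt ?_
    rwa [← dist_eq_norm]
  have h2 := dist_triangle4 (T m x) (T m d) (T n d) (T n x)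
  have h3 := h1 n
  rw [dist_comm] at h3
  linarith [h1 m, hN m hm n hn]

/-- `B` is the resolvent `(A - z)⁻¹`. -/
def IsResolventAt (A : ℋ →ₗ.[ℂ] ℋ) (z : ℂ) (B : ℋ →L[ℂ] ℋ) : Prop :=
  ∀ x y, (x, y + z • x) ∈ A.graph ↔ x = B y

theorem IsResolventAt.mem_graph {z : ℂ} {B : ℋ →L[ℂ] ℋ} (hB : IsResolventAt A z B) (y : ℋ) :
    (B y, y + z • B y) ∈ A.graph :=
  (hB _ _).2 rfl

theorem IsResolventAt.apply_eq {z : ℂ} {B : ℋ →L[ℂ] ℋ} (hB : IsResolventAt A z B) {x y : ℋ}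
    (h : (x, y) ∈ A.graph) : B y = x + z • B x := by
  have h1 : x = B (y - z • x) := (hB _ _).1 (by rwa [sub_add_cancel])
  rw [map_sub, map_smul] at h1
  exact (eq_sub_iff_add_eq.1 h1).symm

theorem IsResolventAt.commute {z w : ℂ} {B C : ℋ →L[ℂ] ℋ} (hB : IsResolventAt A z B)
    (hC : IsResolventAt A w C) : Commute B C := by
  -- The resolvent identity, in the two forms `C - B = (w - z) B C` and `C - B = (w - z) C B`.
  have h1 : ∀ x, C x - B x = (w - z) • B (C x) := by
    intro x
    have h := hB.apply_eq (hC.mem_graph x)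
    rw [map_add, map_smul] at h
    rw [sub_smul, sub_eq_sub_iff_add_eq_add, ← h, add_comm]
  have h2 : ∀ x, B x - C x = (z - w) • C (B x) := by
    intro x
    have h := hC.apply_eq (hB.mem_graph x)
    rw [map_add, map_smul] at h
    rw [sub_smul, sub_eq_sub_iff_add_eq_add, ← h, add_comm]
  by_cases hzw : w - z = 0
  · ext x
    obtain rfl : w = z := sub_eq_zero.1 hzw
    have h3 : C = B := by
      ext y
      have := h1 y
      rwa [hzw, zero_smul, sub_eq_zero] at this
    rw [h3]
  · ext x
    have h3 := h2 x
    rw [← neg_sub, h1, ← neg_sub w z, neg_smul, neg_inj] at h3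
    exact smul_right_injective ℋ hzw h3

variable [CompleteSpace ℋ]

theorem norm_sub_smul_sq (hA : IsSelfAdjoint A) {x y : ℋ} (h : (x, y) ∈ A.graph) (c : ℝ) :
    ‖y - (c * Complex.I : ℂ) • x‖ ^ 2 = ‖y‖ ^ 2 + c ^ 2 * ‖x‖ ^ 2 := by
  have h1 : (⟪x, y⟫_ℂ).im = 0 := by
    have := congrArg Complex.im (inner_conj_symm x y)
    rw [← graph_symmetric hA h h, Complex.conj_im] at this
    linarith
  have h2 : (⟪y, x⟫_ℂ).im = 0 := by rw [← graph_symmetric hA h h, h1]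
  rw [@norm_sub_sq ℂ, norm_smul, inner_smul_right]
  have h3 : RCLike.re ((c * Complex.I : ℂ) * ⟪y, x⟫_ℂ) = 0 := by
    change ((c * Complex.I : ℂ) * ⟪y, x⟫_ℂ).re = 0
    simp [h2]
  rw [h3, norm_mul, Complex.norm_I, Complex.norm_real, mul_one, mul_pow, Real.norm_eq_abs, sq_abs]
  ring

theorem le_norm_sub_smul (hA : IsSelfAdjoint A) {x y : ℋ} (h : (x, y) ∈ A.graph) (c : ℝ) :
    |c| * ‖x‖ ≤ ‖y - (c * Complex.I : ℂ) • x‖ := by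
  refine abs_le_of_sq_le_sq' ?_ (norm_nonneg _) |>.2
  rw [norm_sub_smul_sq hA h, mul_pow, sq_abs]
  exact le_add_of_nonneg_left (sq_nonneg _)

theorem exists_isResolventAt (hA : IsSelfAdjoint A) {c : ℝ} (hc : c ≠ 0) :
    ∃ B, IsResolventAt A (c * Complex.I) B ∧ ∀ x, |c| * ‖B x‖ ≤ ‖x‖ := by
  obtain ⟨B, hB⟩ := exists_resolvent hA (c * Complex.I) (abs_pos.2 hc)
    (fun x y h => le_norm_sub_smul hA h c) (fun x y h => by
      have := le_norm_sub_smul hA h (-c)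
      rw [abs_neg] at this
      convert this using 4
      simp)
  refine ⟨B, hB, fun x => ?_⟩
  have h1 := le_norm_sub_smul hA ((hB _ _).2 rfl) c (x := B x) (y := x + (c * Complex.I : ℂ) • B x)
  rwa [add_sub_cancel_right] at h1

/-- The Yosida approximations: bounded self-adjoint operators `n² A (A² + n²)⁻¹` that commute with
each other and converge to `A` on its domain. -/
theorem exists_yosida (hA : IsSelfAdjoint A) :
    ∃ C : ℕ → ℋ →L[ℂ] ℋ, (∀ n, IsSelfAdjoint (C n)) ∧ (∀ m n, Commute (C m) (C n)) ∧
      ∀ x y, (x, y) ∈ A.graph → Filter.Tendsto (fun n => C n x) Filter.atTop (nhds y) := by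
  have hc : ∀ n : ℕ, ((n : ℝ) + 1) ≠ 0 := fun n => by positivity
  choose P hP hPn using fun n : ℕ => exists_isResolventAt hA (hc n)
  choose Q hQ hQn using fun n : ℕ => exists_isResolventAt hA (neg_ne_zero.2 (hc n))
  have habs : ∀ n : ℕ, |(n : ℝ) + 1| = n + 1 := fun n => abs_of_pos (by positivity)
  simp only [abs_neg, habs] at hPn hQn
  have hadj : ∀ n x y, ⟪P n x, y⟫_ℂ = ⟪x, Q n y⟫_ℂ := by
    intro n x y
    have h := graph_symmetric hA ((hP n).mem_graph x) ((hQ n).mem_graph y)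
    rw [inner_add_right, inner_add_left, inner_smul_left, inner_smul_right] at h
    simp only [map_mul, Complex.conj_ofReal, Complex.conj_I] at h
    push_cast at h
    linear_combination h
  let C : ℕ → ℋ →L[ℂ] ℋ := fun n => ((((n : ℝ) + 1) ^ 2 / 2 : ℝ) : ℂ) • (P n + Q n)
  let J : ℕ → ℋ →L[ℂ] ℋ := fun n =>
    (((((n : ℝ) + 1) / 2 : ℝ) : ℂ) * -Complex.I) • (P n - Q n)
  have hJ1 : ∀ n x, ‖J n x‖ ≤ ‖x‖ := by
    intro n x
    change ‖(((((n : ℝ) + 1) / 2 : ℝ) : ℂ) * -Complex.I) • (P n x - Q n x)‖ ≤ _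
    rw [norm_smul, norm_mul, norm_neg, Complex.norm_I, mul_one, Complex.norm_real,
      Real.norm_of_nonneg (by positivity)]
    have h1 : ‖P n x - Q n x‖ ≤ ‖P n x‖ + ‖Q n x‖ := norm_sub_le _ _
    have h2 := hPn n x
    have h3 := hQn n x
    have h4 : (0 : ℝ) < n + 1 := by positivity
    nlinarith
  have hCJ : ∀ n x y, (x, y) ∈ A.graph → C n x = J n y := by
    intro n x y h
    have h1 := (hP n).apply_eq h
    have h2 := (hQ n).apply_eq h
    change ((((n : ℝ) + 1) ^ 2 / 2 : ℝ) : ℂ) • (P n x + Q n x) =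
      (((((n : ℝ) + 1) / 2 : ℝ) : ℂ) * -Complex.I) • (P n y - Q n y)
    rw [h1, h2, add_sub_add_left_eq_sub, smul_sub, smul_smul, smul_smul, smul_add, sub_eq_add_neg,
      ← neg_smul]
    congr 2
    · push_cast
      linear_combination (((n : ℂ) + 1) ^ 2 / 2) * Complex.I_sq
    · push_cast
      linear_combination (((n : ℂ) + 1) ^ 2 / 2) * Complex.I_sq
  have hJlim : ∀ y z, (y, z) ∈ A.graph → ∀ n, ‖J n y - y‖ ≤ ‖z‖ * (1 / ((n : ℝ) + 1)) := by
    intro y z h n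
    have h1 := (hP n).apply_eq h
    have h2 := (hQ n).apply_eq h
    have h3 : J n y - y = -((1 / 2 : ℝ) : ℂ) • (P n z + Q n z) := by
      change (((((n : ℝ) + 1) / 2 : ℝ) : ℂ) * -Complex.I) • (P n y - Q n y) - y = _
      rw [h1, h2]
      push_cast
      module
    rw [h3, norm_smul, norm_neg, Complex.norm_real, Real.norm_of_nonneg (by norm_num)]
    have h4 := norm_add_le (P n z) (Q n z)
    have h5 := hPn n z
    have h6 := hQn n z
    have h7 : (0 : ℝ) < n + 1 := by positivity
    rw [mul_one_div, le_div_iff₀ h7]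
    nlinarith
  have hJlim' : ∀ y, Filter.Tendsto (fun n => J n y) Filter.atTop (nhds y) := by
    intro y
    rw [Metric.tendsto_atTop]
    intro ε hε
    obtain ⟨d, hdD, hd⟩ := hA.dense_domain.exists_dist_lt y (by positivity : 0 < ε / 3)
    obtain ⟨z, hz⟩ := mem_domain_iff_graph.1 hdD
    have h1 : Filter.Tendsto (fun n : ℕ => ‖z‖ * (1 / ((n : ℝ) + 1))) Filter.atTop (nhds 0) := by
      simpa using (tendsto_one_div_add_atTop_nhds_zero_nat (𝕜 := ℝ)).const_mul ‖z‖
    obtain ⟨N, hN⟩ := Metric.tendsto_atTop.1 h1 (ε / 3) (by positivity)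
    refine ⟨N, fun n hn => ?_⟩
    have h2 : dist (J n y) (J n d) < ε / 3 := by
      rw [dist_eq_norm, ← map_sub]
      exact (hJ1 n _).trans_lt (by rwa [← dist_eq_norm])
    have h3 : dist (J n d) d < ε / 3 := by
      rw [dist_eq_norm]
      refine (hJlim d z hz n).trans_lt ((le_abs_self _).trans_lt ?_)
      simpa only [Real.dist_eq, sub_zero] using hN n hn
    have h4 := dist_triangle4 (J n y) (J n d) d y
    rw [dist_comm] at hd
    linarith
  refine ⟨C, fun n => ?_, fun m n => ?_, fun x y h => ?_⟩
  · rw [ContinuousLinearMap.isSelfAdjoint_iff_isSymmetric]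
    intro x y
    change ⟪((((n : ℝ) + 1) ^ 2 / 2 : ℝ) : ℂ) • (P n x + Q n x), y⟫_ℂ =
      ⟪x, ((((n : ℝ) + 1) ^ 2 / 2 : ℝ) : ℂ) • (P n y + Q n y)⟫_ℂ
    have h1 : ⟪Q n x, y⟫_ℂ = ⟪x, P n y⟫_ℂ := by
      rw [← inner_conj_symm, ← hadj, inner_conj_symm]
    rw [inner_smul_left, inner_smul_right, Complex.conj_ofReal, inner_add_left, inner_add_right,
      hadj, h1, add_comm ⟪x, Q n y⟫_ℂ]
  · have h1 := ((hP m).commute (hP n)).add_right ((hP m).commute (hQ n))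
    have h2 := ((hQ m).commute (hP n)).add_right ((hQ m).commute (hQ n))
    exact ((h1.add_left h2).smul_left _).smul_right _
  · simp only [hCJ _ x y h]
    exact hJlim' y

/-- The generator of a strongly continuous unitary group is symmetric, so it cannot properly extend
a self-adjoint operator. -/
theorem mem_graph_of_hasDerivAt (hA : IsSelfAdjoint A) {V : ℝ → ℋ →L[ℂ] ℋ}
    (hV : ∀ t x y, ⟪V t x, y⟫_ℂ = ⟪x, V (-t) y⟫_ℂ)
    (hgen : ∀ x y, (x, y) ∈ A.graph → HasDerivAt (fun t => V t x) (Complex.I • y) 0) {x y : ℋ}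
    (h : HasDerivAt (fun t => V t x) (Complex.I • y) 0) : (x, y) ∈ A.graph := by
  refine mem_graph_of_forall_inner hA fun u v huv => ?_
  have h1 : HasDerivAt (fun t : ℝ => ⟪V t x, u⟫_ℂ) ⟪Complex.I • y, u⟫_ℂ 0 := by
    simpa only [inner_zero_right, zero_add] using h.inner ℂ (hasDerivAt_const (0 : ℝ) u)
  have h2 : HasDerivAt (fun t : ℝ => V (-t) u) (-(Complex.I • v)) 0 := by
    have h3 : HasDerivAt (fun t => V t u) (Complex.I • v) (-(0 : ℝ)) := by
      rw [neg_zero]; exact hgen u v huv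
    have h4 := h3.scomp (0 : ℝ) (hasDerivAt_neg (0 : ℝ))
    rwa [neg_one_smul] at h4
  have h4 : HasDerivAt (fun t : ℝ => ⟪V t x, u⟫_ℂ) ⟪x, -(Complex.I • v)⟫_ℂ 0 := by
    have h5 := (hasDerivAt_const (0 : ℝ) x).inner ℂ h2
    simp only [inner_zero_left, add_zero] at h5
    simpa only [hV] using h5
  have h6 := h1.unique h4
  rw [inner_smul_left, inner_neg_right, inner_smul_right, Complex.conj_I] at h6
  have h7 : Complex.I * (⟪x, v⟫_ℂ - ⟪y, u⟫_ℂ) = 0 := by linear_combination h6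
  exact sub_eq_zero.1 ((mul_eq_zero.1 h7).resolve_left Complex.I_ne_zero)

/-- Stone's theorem, existence part: a self-adjoint operator generates a strongly continuous
unitary group, the strong limit of the groups of its Yosida approximations. -/
theorem exists_isUnitaryGroup (hA : IsSelfAdjoint A) : ∃ V, IsUnitaryGroup A V := by
  obtain ⟨C, hC, hcomm, hlim⟩ := exists_yosida hA
  have hdense : Dense (A.domain : Set ℋ) := hA.dense_domain
  have hcauchy : ∀ t x, CauchySeq fun n => boundedGroup (C n) t x := by
    intro t
    refine cauchySeq_apply_of_dense (fun n x => (norm_boundedGroup_apply (hC n) t x).le) hdense ?_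
    intro x hx
    obtain ⟨y, hy⟩ := mem_domain_iff_graph.1 hx
    rw [Metric.cauchySeq_iff]
    intro ε hε
    obtain ⟨N, hN⟩ := Metric.cauchySeq_iff.1 (hlim x y hy).cauchySeq (ε / (|t| + 1))
      (by positivity)
    refine ⟨N, fun m hm n hn => ?_⟩
    have h1 := hN m hm n hn
    rw [dist_eq_norm, lt_div_iff₀ (by positivity)] at h1
    rw [dist_eq_norm]
    refine (norm_boundedGroup_sub_boundedGroup_le (hC m) (hC n) (hcomm m n) t x).trans_lt ?_
    nlinarith [norm_nonneg (C m x - C n x), abs_nonneg t]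
  choose f hf using fun t x => cauchySeq_tendsto_of_complete (hcauchy t x)
  let V : ℝ → ℋ →L[ℂ] ℋ := fun t => continuousLinearMapOfTendsto (fun n => boundedGroup (C n) t)
    (tendsto_pi_nhds.2 (hf t))
  have hV : ∀ t x, Filter.Tendsto (fun n => boundedGroup (C n) t x) Filter.atTop (nhds (V t x)) :=
    hf
  have hVnorm : ∀ t x, ‖V t x‖ = ‖x‖ := fun t x =>
    tendsto_nhds_unique (hV t x).norm (by
      simp only [norm_boundedGroup_apply (hC _)]
      exact tendsto_const_nhds)
  have hV0 : V 0 = 1 := by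
    ext x
    refine tendsto_nhds_unique (hV 0 x) ?_
    simp only [boundedGroup_zero, one_apply_eq_self]
    exact tendsto_const_nhds
  have hVadd : ∀ s t, V (s + t) = V s * V t := by
    intro s t
    ext x
    refine tendsto_nhds_unique (hV (s + t) x) ?_
    simp only [boundedGroup_add, mul_apply_eq_comp]
    have h1 : Filter.Tendsto (fun n => boundedGroup (C n) s (boundedGroup (C n) t x - V t x))
        Filter.atTop (nhds 0) := by
      rw [tendsto_zero_iff_norm_tendsto_zero]
      simp only [norm_boundedGroup_apply (hC _)]
      rw [← tendsto_zero_iff_norm_tendsto_zero]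
      simpa using (hV t x).sub_const (V t x)
    have h2 := h1.add (hV s (V t x))
    simpa only [map_sub, sub_add_cancel, zero_add] using h2
  have hVadj : ∀ t x y, ⟪V t x, y⟫_ℂ = ⟪x, V (-t) y⟫_ℂ := by
    intro t x y
    have h1 := (hV t x).inner (tendsto_const_nhds (x := y)) (𝕜 := ℂ)
    have h2 := (tendsto_const_nhds (x := x)).inner (hV (-t) y) (𝕜 := ℂ)
    simp only [inner_boundedGroup_left (hC _)] at h1
    exact tendsto_nhds_unique h1 h2
  have hVstar : ∀ t, star (V t) = V (-t) := by
    intro t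
    ext y
    refine ext_inner_left ℂ fun x => ?_
    rw [← hVadj]
    exact ContinuousLinearMap.adjoint_inner_right (V t) x y
  have hVmem : ∀ t, V t ∈ unitary (ℋ →L[ℂ] ℋ) := fun t => by
    rw [Unitary.mem_iff, hVstar, ← hVadd, ← hVadd, neg_add_cancel, add_neg_cancel, hV0]
    exact ⟨rfl, rfl⟩
  have hVsub : ∀ t x y, (x, y) ∈ A.graph → ‖V t x - x‖ ≤ |t| * ‖y‖ := fun t x y h =>
    le_of_tendsto_of_tendsto' ((hV t x).sub_const x).norm ((hlim x y h).norm.const_mul |t|)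
      fun n => norm_boundedGroup_sub_le (hC n) t x
  have hVexp : ∀ t x y w z, (x, y) ∈ A.graph → (w, z) ∈ A.graph →
      ‖V t x - x - t • (Complex.I • w)‖ ≤ (‖y - w‖ + |t| * ‖z‖) * |t| := fun t x y w z h h' =>
    le_of_tendsto_of_tendsto' (((hV t x).sub_const x).sub_const _).norm
      ((((hlim x y h).sub_const w).norm.add ((hlim w z h').norm.const_mul |t|)).mul_const |t|)
      fun n => norm_boundedGroup_sub_sub_le (hC n) t x w
  have hgen : ∀ x y, (x, y) ∈ A.graph → HasDerivAt (fun t => V t x) (Complex.I • y) 0 := by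
    intro x y h
    rw [hasDerivAt_iff_isLittleO_nhds_zero, Asymptotics.isLittleO_iff]
    intro ε hε
    obtain ⟨w, hw, hyw⟩ := hdense.exists_dist_lt y (by positivity : 0 < ε / 3)
    obtain ⟨z, hz⟩ := mem_domain_iff_graph.1 hw
    rw [dist_eq_norm] at hyw
    have hz0 : 0 < ε / 3 / (‖z‖ + 1) := by positivity
    filter_upwards [Metric.ball_mem_nhds (0 : ℝ) hz0] with t ht
    have ht' : |t| * (‖z‖ + 1) < ε / 3 := by
      rwa [mem_ball_zero_iff, Real.norm_eq_abs, lt_div_iff₀ (by positivity)] at ht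
    have h1 := hVexp t x y w z h hz
    have h2 : V (0 + t) x - V 0 x - t • Complex.I • y =
        (V t x - x - t • (Complex.I • w)) - t • (Complex.I • (y - w)) := by
      rw [zero_add, hV0, one_apply_eq_self, smul_sub, smul_sub]
      abel
    rw [h2, Real.norm_eq_abs]
    refine (norm_sub_le _ _).trans ?_
    rw [norm_smul, norm_smul, Complex.norm_I, one_mul, Real.norm_eq_abs]
    have h3 := abs_nonneg t
    have h4 : (‖y - w‖ + |t| * ‖z‖) * |t| + |t| * ‖y - w‖ ≤ ε * |t| := by
      have h5 : ‖y - w‖ + |t| * ‖z‖ + ‖y - w‖ ≤ ε := by nlinarith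
      nlinarith
    linarith
  have hcont0 : ∀ x, Filter.Tendsto (fun t => V t x) (nhds 0) (nhds x) := by
    intro x
    rw [Metric.tendsto_nhds]
    intro ε hε
    obtain ⟨w, hw, hxw⟩ := hdense.exists_dist_lt x (by positivity : 0 < ε / 3)
    obtain ⟨z, hz⟩ := mem_domain_iff_graph.1 hw
    have h1 : ContinuousAt (fun t => V t w) 0 := (hgen w z hz).continuousAt
    have h2 := Metric.tendsto_nhds.1 h1 (ε / 3) (by positivity)
    filter_upwards [h2] with t ht
    rw [hV0, one_apply_eq_self] at ht
    have h3 : dist (V t x) (V t w) = dist x w := by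
      rw [dist_eq_norm, ← map_sub, hVnorm, dist_eq_norm]
    have h4 := dist_triangle4 (V t x) (V t w) w x
    rw [dist_comm w x] at h4
    linarith
  refine ⟨fun t => ⟨V t, hVmem t⟩, ?_, ?_, ?_, ?_⟩
  · exact Subtype.ext hV0
  · exact fun s t => Subtype.ext (hVadd s t)
  · intro x
    refine continuous_iff_continuousAt.2 fun t => ?_
    have h1 : Filter.Tendsto (fun s => V (s - t) x) (nhds t) (nhds x) := by
      refine (hcont0 x).comp ?_
      rw [← sub_self t]
      exact (continuous_id.sub continuous_const).tendsto t
    have h2 := ((V t).continuous.tendsto x).comp h1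
    have h3 : (fun s => V s x) = (V t) ∘ fun s => V (s - t) x := by
      funext s
      rw [Function.comp_apply, ← mul_apply_eq_comp, ← hVadd, add_sub_cancel]
    change Filter.Tendsto (fun s => V s x) (nhds t) (nhds (V t x))
    rw [h3]
    exact h2
  · exact fun x y => ⟨hgen x y, mem_graph_of_hasDerivAt hA hVadj hgen⟩

theorem isUnitaryGroup_expI (hA : IsSelfAdjoint A) : IsUnitaryGroup A (expI A) := by
  have h := exists_isUnitaryGroup hA
  have h1 : expI A = h.choose := by
    funext l
    rw [expI, dif_pos h]
  rw [h1]
  exact h.choose_spec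

end Stone

/-! ### The evolution in the Schrödinger picture -/

section Evolution

/-- Product rule for a strongly, but not necessarily norm, differentiable family of
contractions. -/
theorem hasDerivAt_contraction_apply {T : ℝ → ℋ →L[ℂ] ℋ} (hT : ∀ t x, ‖T t x‖ ≤ ‖x‖)
    (hTc : ∀ x, Continuous fun t => T t x) {z : ℝ → ℋ} {z' d : ℋ} {s : ℝ}
    (hz : HasDerivAt z z' s) (hd : HasDerivAt (fun t => T t (z s)) d s) :
    HasDerivAt (fun t => T t (z t)) (d + T s z') s := by
  rw [hasDerivAt_iff_isLittleO] at hz hd ⊢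
  have h1 : (fun t => T t (z t - z s - (t - s) • z')) =o[nhds s] fun t => t - s :=
    (Asymptotics.IsBigO.of_bound 1 (Filter.Eventually.of_forall fun t => by
      rw [one_mul]
      exact hT t _)).trans_isLittleO hz
  have h2 : (fun t => (t - s) • (T t z' - T s z')) =o[nhds s] fun t => t - s := by
    have h3 : Filter.Tendsto (fun t => T t z' - T s z') (nhds s) (nhds 0) := by
      have := ((hTc z').tendsto s).sub_const (T s z')
      rwa [sub_self] at this
    have h4 := (Asymptotics.isBigO_refl (fun t => t - s) (nhds s)).smul_isLittleO
      ((Asymptotics.isLittleO_one_iff ℝ).2 h3)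
    simpa using h4
  refine ((hd.add h1).add h2).congr_left fun t => ?_
  have h3 : T t ((t - s) • z') = (t - s) • T t z' := by
    rw [← Complex.coe_smul, map_smul, Complex.coe_smul]
  rw [map_sub, map_sub, h3, smul_add, smul_sub]
  abel

variable [CompleteSpace ℋ]

theorem IsUnitaryGroup.star_eq {A : ℋ →ₗ.[ℂ] ℋ} {V : ℝ → unitary (ℋ →L[ℂ] ℋ)}
    (hV : IsUnitaryGroup A V) (l : ℝ) : star (V l) = V (-l) := by
  have h : V (-l) * V l = 1 := by rw [← hV.add, neg_add_cancel, hV.zero]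
  calc star (V l) = V (-l) * V l * star (V l) := by rw [h, one_mul]
    _ = V (-l) := by rw [mul_assoc, Unitary.mul_star_self, mul_one]

theorem IsUnitaryGroup.mem_graph {A : ℋ →ₗ.[ℂ] ℋ} {V : ℝ → unitary (ℋ →L[ℂ] ℋ)}
    (hV : IsUnitaryGroup A V) {x y : ℋ} (h : (x, y) ∈ A.graph) (l : ℝ) :
    ((V l : ℋ →L[ℂ] ℋ) x, (V l : ℋ →L[ℂ] ℋ) y) ∈ A.graph := by
  rw [hV.generator]
  have h1 := hasDerivAt_operator_apply (hasDerivAt_const (0 : ℝ) (V l : ℋ →L[ℂ] ℋ))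
    ((hV.generator x y).1 h)
  rw [zero_apply, zero_add, map_smul] at h1
  convert! h1 using 2 with t
  have h2 : V t * V l = V l * V t := by rw [← hV.add, ← hV.add, add_comm]
  exact congrArg (fun T : unitary (ℋ →L[ℂ] ℋ) => (T : ℋ →L[ℂ] ℋ) x) h2

theorem IsUnitaryGroup.hasDerivAt {A : ℋ →ₗ.[ℂ] ℋ} {V : ℝ → unitary (ℋ →L[ℂ] ℋ)}
    (hV : IsUnitaryGroup A V) {x y : ℋ} (h : (x, y) ∈ A.graph) (l : ℝ) :
    HasDerivAt (fun t => (V t : ℋ →L[ℂ] ℋ) x) (Complex.I • (V l : ℋ →L[ℂ] ℋ) y) l := by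
  have h1 : HasDerivAt (fun t => (V t : ℋ →L[ℂ] ℋ) ((V l : ℋ →L[ℂ] ℋ) x))
      (Complex.I • (V l : ℋ →L[ℂ] ℋ) y) (l - l) := by
    rw [sub_self]
    exact (hV.generator _ _).1 (hV.mem_graph h l)
  have h2 := h1.comp_sub_const l l
  convert! h2 using 2 with t
  have h3 : V t = V (t - l) * V l := by rw [← hV.add, sub_add_cancel]
  exact congrArg (fun T : unitary (ℋ →L[ℂ] ℋ) => (T : ℋ →L[ℂ] ℋ) x) h3

variable {H₀ H₁ : ℋ →ₗ.[ℂ] ℋ} {g : ℝ → ℝ} {γ₀ εs a b ε η : ℝ}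
  {U : ℝ → ℝ → unitary (ℋ →L[ℂ] ℋ)}

/-- Undoing the gauge transformation turns a solution of the evolution equation of the interaction
picture into a solution `y` of `i η y' = (H₀ + ε g(s) H₁) y`. -/
theorem IsPropagator.exists_schrodinger (hA : Standing H₀ H₁ g γ₀ εs a b)
    (hη : 0 < η) (hU : IsPropagator H₀.domain (interaction H₀ H₁ g ε η) η U) (u : ℝ) {x : ℋ}
    (hx : x ∈ H₀.domain) :
    ∃ y' : ℝ → ℋ, ∀ s,
      HasDerivAt (fun τ => ((star (expI H₁ (ε / η * phase g τ)) : unitary (ℋ →L[ℂ] ℋ)) : ℋ →L[ℂ] ℋ)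
        ((U τ u : ℋ →L[ℂ] ℋ) x)) (y' s) s ∧
      (((star (expI H₁ (ε / η * phase g s)) : unitary (ℋ →L[ℂ] ℋ)) : ℋ →L[ℂ] ℋ)
        ((U s u : ℋ →L[ℂ] ℋ) x), (Complex.I * (η : ℂ)) • y' s) ∈
        (H₀ + ((ε * g s : ℝ) : ℂ) • H₁).graph := by
  have hV := isUnitaryGroup_expI hA.selfAdjoint₁
  have hW : ∀ τ, star (expI H₁ (ε / η * phase g τ)) = expI H₁ (-(ε / η * phase g τ)) := fun τ =>
    hV.star_eq _
  have key : ∀ s, ∃ d, HasDerivAt (fun τ => ((star (expI H₁ (ε / η * phase g τ)) :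
        unitary (ℋ →L[ℂ] ℋ)) : ℋ →L[ℂ] ℋ) ((U τ u : ℋ →L[ℂ] ℋ) x)) d s ∧
      (((star (expI H₁ (ε / η * phase g s)) : unitary (ℋ →L[ℂ] ℋ)) : ℋ →L[ℂ] ℋ)
        ((U s u : ℋ →L[ℂ] ℋ) x), (Complex.I * (η : ℂ)) • d) ∈
        (H₀ + ((ε * g s : ℝ) : ℂ) • H₁).graph := by
    intro s
    obtain ⟨d, hd, hgr⟩ := hU.deriv_left s u x hx
    have hgr' := mem_graph_conj.1 hgr
    set z := (U s u : ℋ →L[ℂ] ℋ) x with hz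
    have hzdom : z ∈ H₀.domain := by
      have h1 : z ∈ (fun x => (U s u : ℋ →L[ℂ] ℋ) x) '' (H₀.domain : Set ℋ) := ⟨x, hx, rfl⟩
      rw [hU.map_domain] at h1
      exact h1
    -- `D(H₀)` is the range of `H₀⁻¹ = H₀^{-1/2} H₀^{-1/2}`, hence contained in `D(H₁)`.
    obtain ⟨v, hv⟩ : ∃ v, (z, v) ∈ H₁.graph := by
      obtain ⟨w, hw⟩ := mem_domain_iff_graph.1 hzdom
      obtain ⟨T, hT, -⟩ := hA.exists_relative
      have h1 := (hA.isBoundedInverse _ _).1 hw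
      rw [← invSqrt_mul_self hA.isBoundedInverse hA.inv_nonneg] at h1
      rw [h1]
      exact ⟨_, hT _⟩
    have hphase : HasDerivAt (fun τ => -(ε / η * phase g τ)) (-(ε / η * g s)) s :=
      ((hasDerivAt_phase hA.contDiff.continuous s).const_mul _).neg
    have hrot := (hV.hasDerivAt hv (-(ε / η * phase g s))).scomp s hphase
    have hcont : ∀ w, Continuous fun τ =>
        (expI H₁ (-(ε / η * phase g τ)) : ℋ →L[ℂ] ℋ) w := fun w => by
      have h1 : Continuous fun τ => -(ε / η * phase g τ) := by
        refine (continuous_const.mul ?_).neg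
        exact continuous_iff_continuousAt.2 fun τ =>
          (hasDerivAt_phase hA.contDiff.continuous τ).continuousAt
      exact (hV.continuous w).comp h1
    have hder := hasDerivAt_contraction_apply (fun τ w => (norm_unitary_apply _ w).le) hcont hd
      hrot
    simp only [hW] at hgr' ⊢
    refine ⟨_, hder, mem_graph_perturbation.2 ⟨_, _, hgr', hV.mem_graph hv _, ?_⟩⟩
    have hη' : (η : ℂ) ≠ 0 := by exact_mod_cast hη.ne'
    rw [smul_add, map_smul, ← Complex.coe_smul, smul_smul, smul_smul, add_comm]
    congr 2
    push_cast
    field_simp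
    linear_combination (-(ε : ℂ) * g s) * Complex.I_sq
  choose y' hy' using key
  exact ⟨y', hy'⟩

/-- A solution of `i η y' = H y` moves along the level sets of `⟨y, H^{-m} y⟩` for frozen `H`. -/
theorem re_inner_pow_eq_zero {H : ℋ →ₗ.[ℂ] ℋ} {R : ℋ →L[ℂ] ℋ} (hR : IsBoundedInverse H R)
    (hsa : IsSelfAdjoint R) (hη : 0 < η) {y y' : ℋ}
    (h : (y, (Complex.I * (η : ℂ)) • y') ∈ H.graph) (m : ℕ) : (⟪y', (R ^ m) y⟫_ℂ).re = 0 := by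
  set w := (Complex.I * (η : ℂ)) • y' with hw
  have hy : y = R w := (hR _ _).1 h
  have h1 : (R ^ m) y = (R ^ (m + 1)) w := by rw [hy, pow_succ]; rfl
  have h2 : (⟪w, (R ^ (m + 1)) w⟫_ℂ).im = 0 := by
    have h3 := congrArg Complex.im (inner_conj_symm w ((R ^ (m + 1)) w))
    rw [inner_pow_left hsa, Complex.conj_im] at h3
    linarith
  rw [← h1, hw, inner_smul_left] at h2
  have h3 : -η * (⟪y', (R ^ m) y⟫_ℂ).re = 0 := by
    simpa using h2
  exact (mul_eq_zero.1 h3).resolve_left (by linarith)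

end Evolution

/-! ### Energy bounds for the propagator -/

section Constants

/-- The exponent `ε ∑_{q ≤ m} (α + β ε + γ_q)`, which is what the recursion for `energyConst`
would give if each factor `C_{q-1}(ε)` in the exponents were replaced by `1`. -/
def energyExponent (α β : ℝ) (γ : ℕ → ℝ) (ε : ℝ) (m : ℕ) : ℝ :=
  ∑ q ∈ Finset.Icc 1 m, (α + β * ε + γ q)

theorem exp_energyExponent_le {α β ε : ℝ} {γ : ℕ → ℝ} (hα : 0 ≤ α) (hβ : 0 ≤ β) (hε : 0 ≤ ε)
    {m : ℕ} (hγ : ∀ q, 1 ≤ q → q ≤ m → 0 ≤ γ q) :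
    1 ≤ energyConst α β γ ε m ∧
      Real.exp (ε * energyExponent α β γ ε m) ≤ energyConst α β γ ε m := by
  induction m with
  | zero => simp [energyConst, energyExponent]
  | succ m ih =>
    obtain ⟨h1, h2⟩ := ih fun q hq hqm => hγ q hq (by omega)
    have h3 : 0 ≤ α + β * ε + γ (m + 1) := by
      have := hγ (m + 1) (by omega) le_rfl
      positivity
    have h4 : (α + β * ε + γ (m + 1)) * ε ≤
        energyConst α β γ ε m * (α + β * ε + γ (m + 1)) * ε :=
      mul_le_mul_of_nonneg_right (le_mul_of_one_le_left h3 h1) hε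
    have h5 : 0 ≤ (α + β * ε + γ (m + 1)) * ε := mul_nonneg h3 hε
    constructor
    · exact one_le_mul_of_one_le_of_one_le h1 (Real.one_le_exp (h5.trans h4))
    · rw [energyExponent, Finset.sum_Icc_succ_top (by omega), mul_add, Real.exp_add]
      refine mul_le_mul h2 (Real.exp_le_exp.2 ?_) (Real.exp_pos _).le (by linarith)
      rwa [mul_comm]

theorem exp_le_one_add_mul_exp (t : ℝ) : Real.exp t ≤ 1 + t * Real.exp t := by
  have h1 := Real.add_one_le_exp (-t)
  have h2 : Real.exp (-t) * Real.exp t = 1 := by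
    rw [← Real.exp_add, neg_add_cancel, Real.exp_zero]
  nlinarith [Real.exp_pos t]

end Constants

section Energy

variable [CompleteSpace ℋ] {H₀ H₁ K : ℋ →ₗ.[ℂ] ℋ} {g : ℝ → ℝ} {γ₀ εs a b : ℝ} {E : ℤ → ℝ}

theorem gammaConst_nonneg {m : ℕ} (hE : ∀ k : ℕ, 1 ≤ k → k ≤ m → 0 ≤ E (-(k : ℤ))) (q : ℕ)
    (hq : q ≤ m) : 0 ≤ gammaConst g E q :=
  mul_nonneg (maxAbs_nonneg _) (Finset.sum_nonneg fun k hk =>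
    hE k (Finset.mem_Icc.1 hk).1 ((Finset.mem_Icc.1 hk).2.trans hq))

theorem Standing.alphaConst_nonneg (hA : Standing H₀ H₁ g γ₀ εs a b) : 0 ≤ alphaConst g a b :=
  mul_nonneg (maxAbs_nonneg _) (add_nonneg hA.a_nonneg hA.b_nonneg)

theorem Standing.betaConst_nonneg (hA : Standing H₀ H₁ g γ₀ εs a b) : 0 ≤ betaConst H₀ H₁ g a :=
  mul_nonneg (maxAbs_nonneg _) (mul_nonneg (mul_nonneg (mul_nonneg (by norm_num) hA.a_nonneg)
    (maxAbs_nonneg _)) (opNorm_nonneg _))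

theorem Standing.maxAbs_mul_growthRate_le (hA : Standing H₀ H₁ g γ₀ εs a b) {ε : ℝ} (hε : 0 ≤ ε)
    (m : ℕ) :
    maxAbs (deriv g) * growthRate (fun k => E (-(k : ℤ)))
        (a * (1 + ε * maxAbs g * opNorm (comp H₁ (halfPow H₀ (-1)))) + b) m ≤
      energyExponent (alphaConst g a b) (betaConst H₀ H₁ g a) (gammaConst g E) ε m := by
  rw [growthRate, energyExponent, Finset.mul_sum]
  refine Finset.sum_le_sum fun q _ => ?_
  rw [gammaConst, alphaConst, betaConst, mul_add]
  have h1 : 0 ≤ maxAbs (deriv g) * (a * maxAbs g * opNorm (comp H₁ (halfPow H₀ (-1)))) * ε :=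
    mul_nonneg (mul_nonneg (maxAbs_nonneg _) (mul_nonneg (mul_nonneg hA.a_nonneg
      (maxAbs_nonneg _)) (opNorm_nonneg _))) hε
  nlinarith

/-- The energy bound for the powers of the inverse Hamiltonian: `‖H_s^{-m/2} y_s‖` grows in the
Schrödinger picture at most by a factor `exp κ`, and passing between `H_s^{-m/2}` and `H₀^{-m/2}`
at the initial and at the final time costs the same factor each time. -/
theorem IsPropagator.norm_invSqrt_pow_le (hA : Standing H₀ H₁ g γ₀ εs a b) {ε η : ℝ}
    (hε : ε ∈ Set.Ioc 0 εs) (hη : 0 < η) {m : ℕ}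
    (hE : ∀ k : ℕ, 1 ≤ k → k ≤ m → 0 ≤ E (-(k : ℤ)))
    (hK : ∀ k : ℕ, 1 ≤ k → k ≤ m → CommutatorBound H₀ H₁ K g εs (-(k : ℤ)) (E (-(k : ℤ))))
    {U : ℝ → ℝ → unitary (ℋ →L[ℂ] ℋ)}
    (hU : IsPropagator H₀.domain (interaction H₀ H₁ g ε η) η U) (s u : ℝ) (x : ℋ) :
    ‖(invSqrt (interaction H₀ H₁ g ε η s) ^ m) ((U s u : ℋ →L[ℂ] ℋ) x)‖ ≤
      Real.exp (ε * energyExponent (alphaConst g a b) (betaConst H₀ H₁ g a) (gammaConst g E) ε m)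
        ^ 3 * ‖(invSqrt (interaction H₀ H₁ g ε η u) ^ m) x‖ := by
  set L := Real.exp (ε * energyExponent (alphaConst g a b) (betaConst H₀ H₁ g a)
    (gammaConst g E) ε m) with hL
  obtain ⟨R, B, hF⟩ := hA.exists_resolventFamily hε
  set c := a * (1 + ε * maxAbs g * opNorm (comp H₁ (halfPow H₀ (-1)))) + b with hc
  have hc0 : 0 ≤ c := by
    have h1 := opNorm_nonneg (comp H₁ (halfPow H₀ (-1)))
    have h2 := maxAbs_nonneg g
    have h3 := hA.a_nonneg
    have h4 := hA.b_nonneg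
    have h5 := hε.1
    positivity
  have hrate : Real.exp (ε * maxAbs (deriv g) * growthRate (fun k => E (-(k : ℤ))) c m) ≤ L := by
    rw [hL, Real.exp_le_exp, mul_assoc]
    exact mul_le_mul_of_nonneg_left (hA.maxAbs_mul_growthRate_le hε.1.le m) hε.1.le
  have hL0 : 0 < L := Real.exp_pos _
  let W : ℝ → unitary (ℋ →L[ℂ] ℋ) := fun s => expI H₁ (ε / η * phase g s)
  have hnorm : ∀ s z, ‖(invSqrt (interaction H₀ H₁ g ε η s) ^ m) z‖ =
      ‖(invSqrt H₀ ^ m) (((star (W s) : unitary (ℋ →L[ℂ] ℋ)) : ℋ →L[ℂ] ℋ) z)‖ := fun s z =>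
    norm_invSqrt_conj_pow_apply hA.isBoundedInverse hA.inv_nonneg (W s) m z
  have hcomp := hF.norm_pow_le_unperturbed hA hε hc0 hE hK
  have hmain : ∀ x ∈ H₀.domain,
      ‖(invSqrt (interaction H₀ H₁ g ε η s) ^ m) ((U s u : ℋ →L[ℂ] ℋ) x)‖ ≤
        L ^ 3 * ‖(invSqrt (interaction H₀ H₁ g ε η u) ^ m) x‖ := by
    intro x hx
    obtain ⟨y', hy'⟩ := hU.exists_schrodinger hA hη u hx
    let y : ℝ → ℋ := fun τ => ((star (W τ) : unitary (ℋ →L[ℂ] ℋ)) : ℋ →L[ℂ] ℋ)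
      ((U τ u : ℋ →L[ℂ] ℋ) x)
    have hgrow := hF.norm_pow_le hA hε hc0 hE hK (y := y) (fun τ => (hy' τ).1)
      (fun τ => re_inner_pow_eq_zero (hF.isBoundedInverse τ) (hF.nonneg τ).isSelfAdjoint hη
        (hy' τ).2 m) s u
    have hyu : y u = ((star (W u) : unitary (ℋ →L[ℂ] ℋ)) : ℋ →L[ℂ] ℋ) x := by
      change ((star (W u) : unitary (ℋ →L[ℂ] ℋ)) : ℋ →L[ℂ] ℋ) ((U u u : ℋ →L[ℂ] ℋ) x) = _
      rw [hU.refl]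
      rfl
    rw [hnorm, hnorm, ← hyu]
    have h1 := (hcomp s (y s)).2
    have h2 := (hcomp u (y u)).1
    calc ‖(invSqrt H₀ ^ m) (y s)‖
        ≤ L * ‖(invSqrt (H₀ + ((ε * g s : ℝ) : ℂ) • H₁) ^ m) (y s)‖ :=
          h1.trans (mul_le_mul_of_nonneg_right hrate (norm_nonneg _))
      _ ≤ L * (L * ‖(invSqrt (H₀ + ((ε * g u : ℝ) : ℂ) • H₁) ^ m) (y u)‖) := by
          gcongr
          exact hgrow.trans (mul_le_mul_of_nonneg_right hrate (norm_nonneg _))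
      _ ≤ L * (L * (L * ‖(invSqrt H₀ ^ m) (y u)‖)) := by
          gcongr
          exact h2.trans (mul_le_mul_of_nonneg_right hrate (norm_nonneg _))
      _ = L ^ 3 * ‖(invSqrt H₀ ^ m) (y u)‖ := by ring
  have hclosed : IsClosed {x : ℋ |
      ‖(invSqrt (interaction H₀ H₁ g ε η s) ^ m) ((U s u : ℋ →L[ℂ] ℋ) x)‖ ≤
        L ^ 3 * ‖(invSqrt (interaction H₀ H₁ g ε η u) ^ m) x‖} :=
    isClosed_le (by fun_prop) (by fun_prop)
  exact hclosed.closure_subset_iff.2 hmain (hA.selfAdjoint₀.dense_domain x)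

/-- Douglas' range inclusion: if `‖T* y‖ ≤ C ‖S y‖` for all `y`, then `T` factors through `S`. -/
theorem exists_apply_eq_of_norm_adjoint_le {S T : ℋ →L[ℂ] ℋ} (hS : IsSelfAdjoint S)
    (hi : Function.Injective S) {C : ℝ} (hC : 0 ≤ C) (h : ∀ y, ‖(star T) y‖ ≤ C * ‖S y‖) (x : ℋ) :
    ∃ z, S z = T x ∧ ‖z‖ ≤ C * ‖x‖ := by
  have hd : DenseRange (S : ℋ →ₗ[ℂ] ℋ) := dense_range_of_selfAdjoint_injective hS hi
  let G : ℋ →L[ℂ] ℋ := LinearMap.extendOfNorm (star T : ℋ →L[ℂ] ℋ).toLinearMap (S : ℋ →ₗ[ℂ] ℋ)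
  have hG : ∀ y, G (S y) = (star T) y := LinearMap.extendOfNorm_eq hd ⟨C, h⟩
  have hGn : ‖star G‖ ≤ C := by
    rw [norm_star]
    exact LinearMap.opNorm_extendOfNorm_le hd hC h
  refine ⟨star G x, ext_inner_left ℂ fun y => ?_, (star G).le_of_opNorm_le hGn x⟩
  have h1 : ⟪y, S (star G x)⟫_ℂ = ⟪S y, star G x⟫_ℂ := (hS.isSymmetric y _).symm
  rw [h1, ContinuousLinearMap.star_eq_adjoint, ContinuousLinearMap.adjoint_inner_right, hG,
    ContinuousLinearMap.star_eq_adjoint, ContinuousLinearMap.adjoint_inner_left]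

/-- An estimate for the bounded powers of the inverses of `A` and `A'`, along a unitary `V` and
along its adjoint, is an operator bound for `A^{-n/2} V A'^{n/2}`, whatever the sign of `n`. -/
theorem normLE_halfPow_comp {A A' : ℋ →ₗ.[ℂ] ℋ} {B B' : ℋ →L[ℂ] ℋ} (hB : IsBoundedInverse A B)
    (h0 : 0 ≤ B) (hB' : IsBoundedInverse A' B') (h0' : 0 ≤ B') (V : unitary (ℋ →L[ℂ] ℋ)) (n : ℤ)
    {C : ℝ} (hC : 0 ≤ C)
    (h : ∀ x, ‖(invSqrt A ^ n.natAbs) ((V : ℋ →L[ℂ] ℋ) x)‖ ≤ C * ‖(invSqrt A' ^ n.natAbs) x‖)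
    (h' : ∀ x, ‖(invSqrt A' ^ n.natAbs) (((star V : unitary (ℋ →L[ℂ] ℋ)) : ℋ →L[ℂ] ℋ) x)‖ ≤
      C * ‖(invSqrt A ^ n.natAbs) x‖) :
    (comp (halfPow A (-n)) (comp (ofBounded (V : ℋ →L[ℂ] ℋ)) (halfPow A' n))).domain =
        (halfPow A' n).domain ∧
      NormLE (comp (halfPow A (-n)) (comp (ofBounded (V : ℋ →L[ℂ] ℋ)) (halfPow A' n))) C := by
  have hgr : ∀ x y, (x, y) ∈ (halfPow A' n).graph → ∃ z,
      ((V : ℋ →L[ℂ] ℋ) y, z) ∈ (halfPow A (-n)).graph ∧ ‖z‖ ≤ C * ‖x‖ := by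
    obtain ⟨q, rfl | rfl⟩ := n.eq_nat_or_neg
    · intro x y hxy
      rw [Int.natAbs_natCast] at h
      obtain rfl := (mem_graph_halfPow hB' h0').1 hxy
      exact ⟨_, mem_graph_halfPow_neg.2 rfl, h y⟩
    · intro x y hxy
      rw [Int.natAbs_neg, Int.natAbs_natCast] at h'
      obtain rfl := mem_graph_halfPow_neg.1 hxy
      rw [neg_neg]
      obtain ⟨z, hz, hzn⟩ := exists_apply_eq_of_norm_adjoint_le
        (S := invSqrt A ^ q) (T := (V : ℋ →L[ℂ] ℋ) * invSqrt A' ^ q)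
        ((isSelfAdjoint_invSqrt A).pow q)
        (injective_pow_of_mul_self (invSqrt_mul_self hB h0) hB.injective q) hC (fun w => by
          rw [star_mul, ((isSelfAdjoint_invSqrt A').pow q).star_eq]
          exact h' w) x
      exact ⟨z, (mem_graph_halfPow hB h0).2 hz.symm, hzn⟩
  have hdom : (comp (halfPow A (-n)) (comp (ofBounded (V : ℋ →L[ℂ] ℋ)) (halfPow A' n))).domain =
      (halfPow A' n).domain := by
    ext x
    rw [mem_domain_iff_graph, mem_domain_iff_graph]
    constructor
    · rintro ⟨z, hz⟩
      obtain ⟨_, hy, -⟩ := mem_graph_comp.1 hz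
      obtain ⟨y, hy, -⟩ := mem_graph_comp.1 hy
      exact ⟨y, hy⟩
    · rintro ⟨y, hy⟩
      obtain ⟨z, hz, -⟩ := hgr x y hy
      exact ⟨z, mem_graph_comp.2 ⟨_, mem_graph_comp.2 ⟨y, hy, mem_graph_ofBounded.2 rfl⟩, hz⟩⟩
  refine ⟨hdom, NormLE.of_graph ?_ fun x z hxz => ?_⟩
  · rw [hdom]
    exact dense_domain_halfPow hB' h0' n
  · obtain ⟨v, hv, hz⟩ := mem_graph_comp.1 hxz
    obtain ⟨y, hy, hv⟩ := mem_graph_comp.1 hv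
    obtain rfl := mem_graph_ofBounded.1 hv
    obtain ⟨z', hz', hn⟩ := hgr x y hy
    rwa [graph_unique hz hz']

end Energy

end EnergyBounds

end

theorem mainTheorem2 {ℋ : Type*} [NormedAddCommGroup ℋ] [InnerProductSpace ℂ ℋ]
    [CompleteSpace ℋ] [TopologicalSpace.SeparableSpace ℋ]
    (H₀ H₁ : ℋ →ₗ.[ℂ] ℋ) (g : ℝ → ℝ) (γ₀ εs a b : ℝ)
    (hA : EnergyBounds.Standing H₀ H₁ g γ₀ εs a b)
    (hInv : EnergyBounds.DomainInvariant H₀ H₁)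
    (n : ℤ)
    (hB₁ : ∀ k : ℕ, 2 ≤ k → k ≤ n.natAbs → EnergyBounds.PowerDomain H₀ H₁ g εs k)
    (K : ℋ →ₗ.[ℂ] ℋ) (E : ℤ → ℝ)
    (hB₂ : ∀ k : ℤ, 1 ≤ |n| → -|n| ≤ k → k ≤ |n| - 2 →
      EnergyBounds.CommutatorBound H₀ H₁ K g εs k (E k)) :
    ∃ D : ℝ, ∀ ε ∈ Set.Ioc 0 εs, ∀ η > 0, ∀ U : ℝ → ℝ → unitary (ℋ →L[ℂ] ℋ),
      EnergyBounds.IsPropagator H₀.domain (EnergyBounds.interaction H₀ H₁ g ε η) η U →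
      ∀ s u : ℝ,
        let right := EnergyBounds.halfPow (EnergyBounds.interaction H₀ H₁ g ε η u) n
        let left := EnergyBounds.halfPow (EnergyBounds.interaction H₀ H₁ g ε η s) (-n)
        let X := EnergyBounds.comp left
          (EnergyBounds.comp (EnergyBounds.ofBounded (U s u : ℋ →L[ℂ] ℋ)) right)
        X.domain = right.domain ∧
        EnergyBounds.NormLE X
          (EnergyBounds.energyConst (EnergyBounds.alphaConst g a b)
            (EnergyBounds.betaConst H₀ H₁ g a) (EnergyBounds.gammaConst g E) ε n.natAbs
            * (1 + ε * D)) := by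
  open EnergyBounds in
  set m := n.natAbs with hm
  set α := alphaConst g a b with hα
  set β := betaConst H₀ H₁ g a with hβ
  set γ := gammaConst g E with hγ
  have hK : ∀ k : ℕ, 1 ≤ k → k ≤ m → CommutatorBound H₀ H₁ K g εs (-(k : ℤ)) (E (-(k : ℤ))) := by
    intro k hk hkm
    have h1 : |n| = (m : ℤ) := Int.abs_eq_natAbs n
    exact hB₂ _ (by omega) (by omega) (by omega)
  -- In the zero space a commutator constant may be negative, so this case is treated separately.
  rcases subsingleton_or_nontrivial ℋ with hℋ | hℋ
  · refine ⟨0, fun ε _ η _ U _ s u => ⟨?_, NormLE.of_graph ?_ fun x y _ => ?_⟩⟩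
    · ext x
      rw [Subsingleton.elim x 0]
      exact iff_of_true (zero_mem _) (zero_mem _)
    · intro x
      rw [Subsingleton.elim x 0]
      exact subset_closure (zero_mem _)
    · rw [Subsingleton.elim x 0, Subsingleton.elim y 0, norm_zero, mul_zero]
  have hE : ∀ k : ℕ, 1 ≤ k → k ≤ m → 0 ≤ E (-(k : ℤ)) := fun k hk hkm =>
    ((hK k hk hkm).2 εs ⟨hA.threshold_pos, le_rfl⟩ 1 one_pos 0).2.nonneg
  have hα0 : 0 ≤ α := hA.alphaConst_nonneg
  have hβ0 : 0 ≤ β := hA.betaConst_nonneg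
  have hγ0 : ∀ q, 1 ≤ q → q ≤ m → 0 ≤ γ q := fun q _ hqm => gammaConst_nonneg hE q hqm
  set X := energyExponent α β γ εs m with hX
  refine ⟨2 * X * Real.exp (2 * (εs * X)), fun ε hε η hη U hU s u => ?_⟩
  obtain ⟨hC1, hCexp⟩ := exp_energyExponent_le hα0 hβ0 hε.1.le hγ0
  have hY0 : 0 ≤ energyExponent α β γ ε m := Finset.sum_nonneg fun q hq => by
    have h1 := hγ0 q (Finset.mem_Icc.1 hq).1 (Finset.mem_Icc.1 hq).2
    have h2 := hε.1
    positivity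
  have hYX : energyExponent α β γ ε m ≤ X := Finset.sum_le_sum fun q _ => by
    have := mul_le_mul_of_nonneg_left hε.2 hβ0
    linarith
  have hsq : Real.exp (ε * energyExponent α β γ ε m) ^ 2 ≤
      1 + ε * (2 * X * Real.exp (2 * (εs * X))) := by
    have h1 : 2 * (ε * energyExponent α β γ ε m) ≤ 2 * (ε * X) := by
      have := mul_le_mul_of_nonneg_left hYX hε.1.le
      linarith
    have h2 : 2 * (ε * X) ≤ 2 * (εs * X) := by
      have := mul_le_mul_of_nonneg_right hε.2 (hY0.trans hYX)
      linarith
    calc Real.exp (ε * energyExponent α β γ ε m) ^ 2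
        = Real.exp (2 * (ε * energyExponent α β γ ε m)) := by
          rw [← Real.exp_nat_mul]; push_cast; rfl
      _ ≤ Real.exp (2 * (ε * X)) := Real.exp_le_exp.2 h1
      _ ≤ 1 + 2 * (ε * X) * Real.exp (2 * (ε * X)) := exp_le_one_add_mul_exp _
      _ ≤ 1 + 2 * (ε * X) * Real.exp (2 * (εs * X)) := by
          have h3 : 0 ≤ 2 * (ε * X) := by
            have := mul_nonneg hε.1.le (hY0.trans hYX)
            linarith
          have h4 := mul_le_mul_of_nonneg_left (Real.exp_le_exp.2 h2) h3
          linarith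
      _ = _ := by ring
  have hcube : Real.exp (ε * energyExponent α β γ ε m) ^ 3 ≤
      energyConst α β γ ε m * (1 + ε * (2 * X * Real.exp (2 * (εs * X)))) := by
    rw [pow_succ']
    exact mul_le_mul hCexp hsq (by positivity) (zero_le_one.trans hC1)
  have hbound : ∀ s u x,
      ‖(invSqrt (interaction H₀ H₁ g ε η s) ^ m) ((U s u : ℋ →L[ℂ] ℋ) x)‖ ≤
        energyConst α β γ ε m * (1 + ε * (2 * X * Real.exp (2 * (εs * X)))) *
          ‖(invSqrt (interaction H₀ H₁ g ε η u) ^ m) x‖ := fun s u x =>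
    (hU.norm_invSqrt_pow_le hA hε hη hE hK s u x).trans
      (mul_le_mul_of_nonneg_right hcube (norm_nonneg _))
  have hstar : star (U s u) = U u s := by
    calc star (U s u) = U u s * U s u * star (U s u) := by
          rw [hU.cocycle, hU.refl, one_mul]
      _ = U u s := by rw [mul_assoc, Unitary.mul_star_self, mul_one]
  exact normLE_halfPow_comp (hA.isBoundedInverse.conj _) (conj_bounded_nonneg hA.inv_nonneg _)
    (hA.isBoundedInverse.conj _) (conj_bounded_nonneg hA.inv_nonneg _) (U s u) n
    ((by positivity : (0 : ℝ) ≤ Real.exp (ε * energyExponent α β γ ε m) ^ 3).trans hcube)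
    (hbound s u) (by rw [hstar]; exact hbound u s)
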